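/- Let $d\ge 1$, $k\ge 0$. For a multi-index $\alpha\in\mathbb Z_+^d$ put $|\alpha|=\sum_i\alpha_i$, $\alpha!=\prod_i\alpha_i!$, $\mathbb P_s=\{\alpha:|\alpha|\le s\}$ (with $\mathbb P_{-1}=\emptyset$), $\mathbb H_s=\{\alpha:|\alpha|=s\}$, and fix a linear order on multi-indices that is graded ($|\alpha|<|\beta|\Rightarrow\alpha\prec\beta$). Let $\#\mathbb P_{k-1}<n\le\#\mathbb P_k$, $\ell=\#\mathbb P_k-n$, and $x_1,\dots,x_n\in\mathbb R^d$. Let $\Omega\subset\mathbb R^d$ be an open set containing $0$ and $K$ a real-valued kernel whose partial derivatives $K^{(\alpha,\beta)}$ (order $\alpha$ in the first and $\beta$ in the second argument), $|\alpha|,|\beta|\le k+1$, all exist and are continuous on $\Omega\times\Omega$. Put $\mathbf K_\varepsilon=[K(\varepsilon x_i,\varepsilon x_j)]_{i,j=1}^n$, and assume that $\mathbf K_\varepsilon$ is symmetric positive semidefinite for all $\varepsilon\in[0,\varepsilon_0]$, for some $\varepsilon_0>0$, and that its entries are analytic in $\varepsilon$ in a neighborhood of $0$. For sets $\mathcal A,\mathcal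 B$ of multi-indices let $\mathbf W_{\mathcal A,\mathcal B}=\big[K^{(\alpha,\beta)}(0,0)/(\alpha!\beta!)\big]_{\alpha\in\mathcal A,\beta\in\mathcal B}$ and $\mathbf V_{\mathcal A}=[x_i^{\alpha}]_{1\le i\le n,\ \alpha\in\mathcal A}$; write $\mathbf W_{\le s}=\mathbf W_{\mathbb P_s,\mathbb P_s}$, $\mathbf V_{\le s}=\mathbf V_{\mathbb P_s}$, $\mathbf V_s=\mathbf V_{\mathbb H_s}$ (an empty determinant is $1$, and a matrix with no columns has full rank). Let $$\widetilde{\mathbf W}_s=\mathbf W_{\mathbb H_s,\mathbb H_s}-\mathbf W_{\mathbb H_s,\mathbb P_{s-1}}\,(\mathbf W_{\le s-1})^{-1}\,\mathbf W_{\mathbb P_{s-1},\mathbb H_s},$$ the Schur complement of $\mathbf W_{\le s-1}$ in $\mathbf W_{\le s}$. Let $\mathbf V_{\le k-1}=\mathbf Q\mathbf R$ be any full QR factorization ($\mathbf Q$ is $n\times n$ orthogonal, $\mathbf R$ is $n\times\#\mathbb P_{k-1}$ upper triangular, the columns of $\mathbf V_{\le k-1}$ being taken in the graded order), and partition $\mathbf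 Q=[\mathbf Q_0\ \mathbf Q_1\cdots\mathbf Q_k]$, where $\mathbf Q_s$ has $m_s$ columns, $m_s=\#\mathbb H_s$ for $s<k$ and $m_k=\#\mathbb H_k-\ell$. Then there exists an analytic eigenvalue decomposition of $\mathbf K_\varepsilon$ near $\varepsilon=0$, i.e. a decomposition $\mathbf K_\varepsilon=\sum_{i=1}^n\lambda_i(\varepsilon)\mathbf P_i(\varepsilon)$ with analytic $\lambda_i$ and analytic, pairwise orthogonal, rank-one orthogonal projectors $\mathbf P_i$. For every such decomposition the indices can be relabelled as $(s,j)$, $0\le s\le k$, with $m_s$ indices $j$ in group $s$ (the single index of group $0$ being written $(0,0)$), so that $$\lambda_{s,j}(\varepsilon)=\varepsilon^{2s}\big(\widetilde\lambda_{s,j}+O(\varepsilon)\big)\qquad(\varepsilon\to0)\quad\text{for all }(s,j).$$ Moreover, for every such decomposition and every such labelling, writing $\mathbf P_{s,j}(0)=p_{s,j}p_{s,j}^{T}$ (so the $p_{s,j}$ are the limiting eigenvectors), one has $\widetilde\lambda_{0,0}=n\,K(0,0)$ and: 1. For $1\le s<k$, if $\det\mathbf W_{\le s-1}\ne0$ and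 $\mathbf V_{\le s-1}$ has full rank, then $$\prod_{j}\widetilde\lambda_{s,j}=\frac{\det(\mathbf V_{\le s}^T\mathbf V_{\le s})\,\det\mathbf W_{\le s}}{\det(\mathbf V_{\le s-1}^T\mathbf V_{\le s-1})\,\det\mathbf W_{\le s-1}}.$$ 2. For $1\le s\le k$, if $\det\mathbf W_{\le s-1}\ne0$ and $\mathbf V_{\le s-1}$ has full rank, then the main terms $\widetilde\lambda_{s,j}$ of group $s$ are the eigenvalues, with multiplicity, of $\mathbf Q_s^T\mathbf V_s\widetilde{\mathbf W}_s\mathbf V_s^T\mathbf Q_s$. 3. For $0\le s<k$, if $\det\mathbf W_{\le s}\ne0$ and $\mathbf V_{\le s}$ has full rank, then the limiting eigenvectors $p_{s,j}$ of group $s$ span the column space of $\mathbf Q_s$. If $\det\mathbf W_{\le k-1}\ne0$ and $\mathbf V_{\le k-1}$ has full rank, then the remaining limiting eigenvectors $p_{k,j}$ span the column space of $\mathbf Q_k$. -/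

import Mathlib

open Filter Topology Asymptotics Polynomial

noncomputable section

/-- The total degree `|α|` of a multi-index. -/
def mdeg {d : ℕ} (α : Fin d → ℕ) : ℕ := ∑ i, α i

/-- The set `ℍ_s` of multi-indices of total degree exactly `s`. -/
def degEq (d s : ℕ) : Finset (Fin d → ℕ) := Finset.univ.piAntidiag s

/-- The set of multi-indices of total degree `< s`, that is `ℙ_{s-1}`, with `ℙ_{-1} = ∅`;
hence `ℙ_s` is `degLT d (s + 1)`. -/
def degLT (d s : ℕ) : Finset (Fin d → ℕ) := (Finset.range s).biUnion (degEq d)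

/-- The factorial `α!` of a multi-index. -/
def mfact {d : ℕ} (α : Fin d → ℕ) : ℕ := ∏ i, (α i).factorial

/-- A graded ordering of the multi-indices, given by listing them increasingly
`e 0 ≺ e 1 ≺ e 2 ≺ …` (a graded linear order on `ℤ_+^d`, `d ≥ 1`, always has order type `ω`,
every multi-index having only finitely many predecessors). -/
def IsGradedEnum {d : ℕ} (e : ℕ ≃ (Fin d → ℕ)) : Prop :=
  ∀ i j, mdeg (e i) < mdeg (e j) → i < j

/-- The partial derivative of a kernel with respect to the `i`-th coordinate of the first
argument. -/
def partialX {d : ℕ} (i : Fin d) (K : (Fin d → ℝ) → (Fin d → ℝ) → ℝ) :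
    (Fin d → ℝ) → (Fin d → ℝ) → ℝ :=
  fun x y => lineDeriv ℝ (fun x' => K x' y) x (Pi.single i 1)

/-- The partial derivative of a kernel with respect to the `i`-th coordinate of the second
argument. -/
def partialY {d : ℕ} (i : Fin d) (K : (Fin d → ℝ) → (Fin d → ℝ) → ℝ) :
    (Fin d → ℝ) → (Fin d → ℝ) → ℝ :=
  fun x y => lineDeriv ℝ (fun y' => K x y') y (Pi.single i 1)

/-- The mixed partial derivative `K^{(α,β)}`. -/
def kernelDeriv {d : ℕ} (K : (Fin d → ℝ) → (Fin d → ℝ) → ℝ) (α β : Fin d → ℕ) :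
    (Fin d → ℝ) → (Fin d → ℝ) → ℝ :=
  (List.finRange d).foldr (fun i G => (partialX i)^[α i] G)
    ((List.finRange d).foldr (fun i G => (partialY i)^[β i] G) K)

/-- The class `C^{(m,m)}(Ω)`: all partial derivatives `K^{(α,β)}` with `|α| ≤ m` and `|β| ≤ m`
exist and are continuous on `Ω × Ω`. Existence is expressed by: differentiating `K^{(α,β)}` once
more in any one coordinate is possible, and gives the derivative with the next multi-index, as
long as both multi-indices stay in the range (on an open set, continuous partial derivatives do
not depend on the order of differentiation). -/
structure IsCmm {d : ℕ} (m : ℕ) (Ω : Set (Fin d → ℝ)) (K : (Fin d → ℝ) → (Fin d → ℝ) → ℝ) :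
    Prop where
  continuousOn : ∀ α β : Fin d → ℕ, mdeg α ≤ m → mdeg β ≤ m →
    ContinuousOn (fun z : (Fin d → ℝ) × (Fin d → ℝ) => kernelDeriv K α β z.1 z.2) (Ω ×ˢ Ω)
  hasDerivX : ∀ (α β : Fin d → ℕ) (i : Fin d), mdeg α + 1 ≤ m → mdeg β ≤ m →
    ∀ x ∈ Ω, ∀ y ∈ Ω, HasLineDerivAt ℝ (fun x' => kernelDeriv K α β x' y)
      (kernelDeriv K (α + Pi.single i 1) β x y) x (Pi.single i 1)
  hasDerivY : ∀ (α β : Fin d → ℕ) (i : Fin d), mdeg α ≤ m → mdeg β + 1 ≤ m →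
    ∀ x ∈ Ω, ∀ y ∈ Ω, HasLineDerivAt ℝ (fun y' => kernelDeriv K α β x y')
      (kernelDeriv K α (β + Pi.single i 1) x y) y (Pi.single i 1)

/-- The Wronskian matrix `W_{A,B}`, with entries `K^{(α,β)}(0,0) / (α! β!)`. -/
def wronskianMatrix {d : ℕ} (K : (Fin d → ℝ) → (Fin d → ℝ) → ℝ) (A B : Finset (Fin d → ℕ)) :
    Matrix A B ℝ :=
  Matrix.of fun α β => kernelDeriv K α β 0 0 / ((mfact α.1 : ℝ) * (mfact β.1 : ℝ))

/-- The Schur complement `W̃ = W_⌟ - W_⌞ (W_{≤ s-1})⁻¹ W_⌝` in the Wronskian `W_{≤ s}`. -/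
def wronskianSchur {d : ℕ} (K : (Fin d → ℝ) → (Fin d → ℝ) → ℝ) (s : ℕ) :
    Matrix (degEq d s) (degEq d s) ℝ :=
  wronskianMatrix K (degEq d s) (degEq d s) -
    wronskianMatrix K (degEq d s) (degLT d s) * (wronskianMatrix K (degLT d s) (degLT d s))⁻¹ *
      wronskianMatrix K (degLT d s) (degEq d s)

/-- The multivariate Vandermonde matrix `V_A`, with entries `(x_i)^α`. -/
def vandermondeND {d n : ℕ} (x : Fin n → Fin d → ℝ) (A : Finset (Fin d → ℕ)) :
    Matrix (Fin n) A ℝ :=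
  Matrix.of fun i α => ∏ l, x i l ^ α.1 l

/-- A matrix has full rank. -/
def IsFullRank {ι κ : Type*} [Fintype ι] [Fintype κ] (A : Matrix ι κ ℝ) : Prop :=
  A.rank = min (Fintype.card ι) (Fintype.card κ)

/-- The scaled kernel matrix `K_ε = [K(ε x_i, ε x_j)]`. -/
def kernelMatrix {d n : ℕ} (K : (Fin d → ℝ) → (Fin d → ℝ) → ℝ) (x : Fin n → Fin d → ℝ) (ε : ℝ) :
    Matrix (Fin n) (Fin n) ℝ :=
  Matrix.of fun i j => K (ε • x i) (ε • x j)

/-- `Q` is the orthogonal factor of a full QR factorization `V = Q R`, where the columns of `V`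
are taken in the order given by `e`. -/
def IsFullQR {d n : ℕ} (e : ℕ ≃ (Fin d → ℕ)) {A : Finset (Fin d → ℕ)}
    (V : Matrix (Fin n) A ℝ) (Q : Matrix (Fin n) (Fin n) ℝ) : Prop :=
  Q.transpose * Q = 1 ∧ ∃ R : Matrix (Fin n) A ℝ, V = Q * R ∧
    ∀ (j : Fin n) (α : A), e.symm α.1 < (j : ℕ) → R j α = 0

/-- The positions `j < n` belonging to group `s`. For `#ℙ_{k-1} < n ≤ #ℙ_k` these are the
positions `#ℙ_{s-1} ≤ j < #ℙ_s` if `s < k`, and the positions `#ℙ_{k-1} ≤ j < n` if `s = k`. -/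
abbrev GroupIdx {d : ℕ} (n : ℕ) (e : ℕ ≃ (Fin d → ℕ)) (s : ℕ) : Type :=
  {j : Fin n // mdeg (e j) = s}

/-- The block `Q_s` of `Q = [Q_0 Q_1 … Q_k]`. -/
def blockQ {d n : ℕ} (e : ℕ ≃ (Fin d → ℕ)) (Q : Matrix (Fin n) (Fin n) ℝ) (s : ℕ) :
    Matrix (Fin n) (GroupIdx n e s) ℝ :=
  Q.submatrix id Subtype.val

/-- The matrix `Q_sᵀ V_s W̃ V_sᵀ Q_s`. -/
def groupMatrix {d n : ℕ} (K : (Fin d → ℝ) → (Fin d → ℝ) → ℝ) (x : Fin n → Fin d → ℝ)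
    (e : ℕ ≃ (Fin d → ℕ)) (Q : Matrix (Fin n) (Fin n) ℝ) (s : ℕ) :
    Matrix (GroupIdx n e s) (GroupIdx n e s) ℝ :=
  (blockQ e Q s).transpose * vandermondeND x (degEq d s) * wronskianSchur K s *
    (vandermondeND x (degEq d s)).transpose * blockQ e Q s

/-- `A(ε) = ∑ j, λ_j(ε) P_j(ε)` is an analytic eigenvalue decomposition near `ε = 0`: the
eigenvalues `λ_j` and the pairwise orthogonal, rank-one orthogonal projectors `P_j` are analytic. -/
structure IsAnalyticEVD {n : ℕ} (A : ℝ → Matrix (Fin n) (Fin n) ℝ) (lam : Fin n → ℝ → ℝ)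
    (P : Fin n → ℝ → Matrix (Fin n) (Fin n) ℝ) : Prop where
  analytic_lam : ∀ j, AnalyticAt ℝ (lam j) 0
  analytic_P : ∀ j a b, AnalyticAt ℝ (fun ε => P j ε a b) 0
  isSymm : ∀ᶠ ε in 𝓝 (0 : ℝ), ∀ j, (P j ε).IsSymm
  isIdempotent : ∀ᶠ ε in 𝓝 (0 : ℝ), ∀ j, P j ε * P j ε = P j ε
  rank_eq_one : ∀ᶠ ε in 𝓝 (0 : ℝ), ∀ j, (P j ε).rank = 1
  orthogonal : ∀ᶠ ε in 𝓝 (0 : ℝ), ∀ i j, i ≠ j → P i ε * P j ε = 0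
  eq_sum : ∀ᶠ ε in 𝓝 (0 : ℝ), A ε = ∑ j, lam j ε • P j ε

/-- The eigenvalues are labelled by groups, with `λ_j(ε) = ε^{2s} (μ_j + O(ε))` as `ε → 0` for
every `j` in group `s`. -/
def HasMainTerms {d n : ℕ} (e : ℕ ≃ (Fin d → ℕ)) (lam : Fin n → ℝ → ℝ) (μ : Fin n → ℝ) : Prop :=
  ∀ j : Fin n, ∃ r : ℝ → ℝ, r =O[𝓝 0] (fun ε => ε) ∧
    ∀ᶠ ε in 𝓝 (0 : ℝ), lam j ε = ε ^ (2 * mdeg (e j)) * (μ j + r ε)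

end

/-! The key is to write `K_ε` in the orthonormal basis given by the columns of `Q`. Since `Qᵀ V = R`
is upper triangular and the order is graded, a column of degree `s` annihilates every monomial of
degree `< s`. Taylor expansion in each argument separately (`tendsto_kernelMatrix_form`) then shows
that entry `(i, j)` of `Qᵀ K_ε Q` is `ε ^ (deg i + deg j) (C i j + o(1))`. The limit `C` is
`limitMatrix`; its blocks have the form `Tᵀ W T`, where `T` is the degree-preserving part of `Vᵀ Q`.

Main terms: the determinant of `Qᵀ K_ε Q - ε ^ (2s) t` equals `∏ (λ_j - ε ^ (2s) t)`. Rescaling rows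
and columns by `ε ^ min (deg, s)` and letting `ε → 0` (`det_limit_eq_prod`) leaves a block
determinant. By the Schur complement formula (`graded_main_terms`) the main terms of degree `< s`
multiply to `det C_{<s}`, and those of degree `s` are the eigenvalues of the Schur complement of
`C_{<s}` in `C_{≤s}`. Cancelling the invertible square block of `T` turns that Schur complement into
`Q_sᵀ V_s W̃_s V_sᵀ Q_s`.

Orders and eigenvectors: for a column `u` of `Q` of degree `s`, the form `uᵀ K_ε u = O(ε ^ (2s))` is
a sum of nonnegative terms `λ_j uᵀ P_j u`. Hence limiting eigenvectors of eigenvalues of order below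
`2s` are orthogonal to `u` (`IsAnalyticEVD.quadForm_eq_zero`). Counting orthonormal vectors bounds
the number of such eigenvalues (`exists_labelling`). When the relevant main terms are nonzero, the
same orthogonality makes `Qᵀ U` block triangular, hence block diagonal, where the columns of `U` are
the limiting eigenvectors.

Existence of the decomposition is Rellich's theorem (`exists_isAnalyticEVD`), obtained by repeatedly
splitting an analytic invariant projector. -/

/-! ### Square roots near the identity and correction to idempotents. -/

section BanachAlgebra

variable {R : Type*} [NormedRing R] [NormedAlgebra ℝ R]

/-- An analytic square root near `1` in a real Banach algebra. -/
theorem exists_analyticAt_sqrt_one (R : Type*) [NormedRing R] [NormedAlgebra ℝ R]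
    [CompleteSpace R] :
    ∃ g : R → R, AnalyticAt ℝ g 1 ∧ g 1 = 1 ∧ ∀ᶠ y in 𝓝 (1 : R), g y * g y = y := by
  let f : R → R := fun y => y * y
  let L : R ≃L[ℝ] R := ContinuousLinearEquiv.smulLeft (Units.mk0 (2 : ℝ) two_ne_zero)
  have hfA : AnalyticAt ℝ f 1 := analyticAt_id.mul analyticAt_id
  -- Here `⊤` is the analytic class, so the local inverse of squaring is analytic. The derivative of
  -- squaring at `1` is multiplication by `2`, hence invertible.
  have hf : ContDiffAt ℝ ⊤ f 1 := hfA.contDiffAt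
  have hf' : HasFDerivAt f (L : R →L[ℝ] R) 1 := by
    have := (hasFDerivAt_id (𝕜 := ℝ) (1 : R)).mul' (hasFDerivAt_id (𝕜 := ℝ) (1 : R))
    refine this.congr_fderiv ?_
    ext y
    simp [L, two_smul, Units.smul_def]
  have h1 : f 1 = 1 := one_mul 1
  have hA := hf.to_localInverse hf' (by simp)
  have hi := (hf.hasStrictFDerivAt' hf' (by simp)).eventually_right_inverse
  have hv := hf.localInverse_apply_image hf' (by simp)
  rw [h1] at hA hi hv
  exact ⟨_, hA.analyticAt, hv, hi⟩

/-- Elements commuting with the square of `y` commute with `y`, if `y` is close to `1`. -/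
theorem commute_of_commute_mul_self {c y : R} (hy : ‖1 - y‖ < 1) (h : Commute c (y * y)) :
    Commute c y := by
  -- For the commutator `D = yc - cy`, the sum `(1 - y) D + D (1 - y)` differs from `2D` by the
  -- commutator of `c` with `y * y`, which is zero. Taking norms gives `‖D‖ ≤ ‖1 - y‖ ‖D‖`, which
  -- forces `D = 0`.
  have hD : (2 : ℝ) • (y * c - c * y) =
      (1 - y) * (y * c - c * y) + (y * c - c * y) * (1 - y) := by
    have h' : c * (y * y) = y * y * c := h
    rw [two_smul]
    have : (1 - y) * (y * c - c * y) + (y * c - c * y) * (1 - y) =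
      (y * c - c * y) + (y * c - c * y) + (c * (y * y) - y * y * c) := by noncomm_ring
    rw [this, h', sub_self, add_zero]
  have hn : 2 * ‖y * c - c * y‖ ≤ 2 * (‖1 - y‖ * ‖y * c - c * y‖) := by
    calc 2 * ‖y * c - c * y‖ = ‖(2 : ℝ) • (y * c - c * y)‖ := by rw [norm_smul]; norm_num
      _ ≤ ‖(1 - y) * (y * c - c * y)‖ + ‖(y * c - c * y) * (1 - y)‖ := by
          rw [hD]; exact norm_add_le _ _
      _ ≤ ‖1 - y‖ * ‖y * c - c * y‖ + ‖y * c - c * y‖ * ‖1 - y‖ :=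
          add_le_add (norm_mul_le _ _) (norm_mul_le _ _)
      _ = _ := by ring
  have h0 : ‖y * c - c * y‖ = 0 := by
    nlinarith [norm_nonneg (y * c - c * y)]
  exact (sub_eq_zero.1 (norm_eq_zero.1 h0)).symm

/-- An analytic family that is idempotent at `0` can be corrected to an analytic family of
idempotents, which commute with everything the given family commutes with. -/
theorem exists_analyticAt_idempotent [CompleteSpace R] {G : ℝ → R} (hG : AnalyticAt ℝ G 0)
    (h0 : G 0 * G 0 = G 0) :
    ∃ P : ℝ → R, AnalyticAt ℝ P 0 ∧ P 0 = G 0 ∧ (∀ᶠ ε in 𝓝 0, P ε * P ε = P ε) ∧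
      ∀ᶠ ε in 𝓝 0, ∀ c, Commute c (G ε) → Commute c (P ε) := by
  obtain ⟨g, hgA, hg1, hg⟩ := exists_analyticAt_sqrt_one R
  -- Idempotents correspond to involutions through `S = 2G - 1`. Dividing `S` by the square root `Y`
  -- of `S²` gives an involution, and `(1 + S Y⁻¹) / 2` is the corrected idempotent. At `0` one has
  -- `S² = 1` and `Y = 1`, so nothing changes there.
  let S : ℝ → R := fun ε => (2 : ℝ) • G ε - 1
  have hSA : AnalyticAt ℝ S 0 :=
    (hG.fun_const_smul (c := (2 : ℝ))).fun_sub analyticAt_const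
  have hS0 : S 0 * S 0 = 1 := by
    have : S 0 * S 0 = (4 : ℝ) • (G 0 * G 0) - (4 : ℝ) • G 0 + 1 := by
      simp only [S, mul_sub, sub_mul, smul_mul_assoc, mul_smul_comm, mul_one, one_mul]
      module
    rw [this, h0, sub_self, zero_add]
  have hSSA : AnalyticAt ℝ (fun ε => S ε * S ε) 0 := hSA.mul hSA
  let Y : ℝ → R := fun ε => g (S ε * S ε)
  have hYA : AnalyticAt ℝ Y 0 := by
    have : AnalyticAt ℝ g ((fun ε => S ε * S ε) 0) := by simpa only [hS0] using hgA
    exact AnalyticAt.fun_comp (f := fun ε => S ε * S ε) this hSSA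
  have hY0 : Y 0 = 1 := by simp only [Y, hS0, hg1]
  have hYY : ∀ᶠ ε in 𝓝 0, Y ε * Y ε = S ε * S ε := by
    have := hSSA.continuousAt.tendsto
    simp only [hS0] at this
    exact this.eventually hg
  have hYn : ∀ᶠ ε in 𝓝 0, ‖1 - Y ε‖ < 1 := by
    have : Tendsto (fun ε => ‖1 - Y ε‖) (𝓝 0) (𝓝 ‖1 - Y 0‖) :=
      (tendsto_const_nhds.sub hYA.continuousAt.tendsto).norm
    rw [hY0, sub_self, norm_zero] at this
    exact this.eventually (gt_mem_nhds one_pos)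
  have hYi : AnalyticAt ℝ (fun ε => Ring.inverse (Y ε)) 0 := by
    have : AnalyticAt ℝ Ring.inverse (Y 0) := by
      rw [hY0]; exact analyticAt_inverse (1 : Rˣ)
    exact AnalyticAt.fun_comp (f := Y) this hYA
  refine ⟨fun ε => (2⁻¹ : ℝ) • (1 + S ε * Ring.inverse (Y ε)),
    (analyticAt_const.fun_add (hSA.fun_mul hYi)).fun_const_smul, ?_, ?_, ?_⟩
  · simp only [hY0, Ring.inverse_one, mul_one, S]
    module
  · filter_upwards [hYY, hYn] with ε h1 h2
    have hu : IsUnit (Y ε) := by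
      have := (Units.oneSub (1 - Y ε) h2).isUnit
      simpa using this
    have hc : Commute (S ε) (Y ε) := by
      refine commute_of_commute_mul_self h2 ?_
      rw [h1]
      exact (Commute.refl _).mul_right (Commute.refl _)
    have hc' : Commute (S ε) (Ring.inverse (Y ε)) := by
      obtain ⟨u, hu⟩ := hu
      rw [← hu, Ring.inverse_unit]
      rw [← hu] at hc
      exact hc.units_inv_right
    have hT : (S ε * Ring.inverse (Y ε)) * (S ε * Ring.inverse (Y ε)) = 1 := by
      rw [hc'.symm.mul_mul_mul_comm, ← h1]
      obtain ⟨u, hu⟩ := hu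
      rw [← hu, Ring.inverse_unit]
      simp [mul_assoc]
    simp only [smul_mul_assoc, mul_smul_comm, mul_add, add_mul, one_mul, mul_one, hT]
    module
  · filter_upwards [hYY, hYn] with ε h1 h2 c hc
    have hcS : Commute c (S ε) := (hc.smul_right _).sub_right (Commute.one_right _)
    have hcY : Commute c (Y ε) := by
      refine commute_of_commute_mul_self h2 ?_
      rw [h1]
      exact hcS.mul_right hcS
    have hu : IsUnit (Y ε) := by
      have := (Units.oneSub (1 - Y ε) h2).isUnit
      simpa using this
    have hcI : Commute c (Ring.inverse (Y ε)) := by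
      obtain ⟨u, hu⟩ := hu
      rw [← hu, Ring.inverse_unit]
      rw [← hu] at hcY
      exact hcY.units_inv_right
    exact ((Commute.one_right _).add_right (hcS.mul_right hcI)).smul_right _

end BanachAlgebra

/-! ### Symmetric idempotent matrices, trace and rank. -/

section Projections

open Matrix

variable {ι : Type*} [Fintype ι]

theorem trace_mul_self_eq_sum_sq {A : Matrix ι ι ℝ} (hs : A.IsSymm) :
    (A * A).trace = ∑ i, ∑ j, A i j ^ 2 := by
  simp only [trace, diag, mul_apply]
  refine Finset.sum_congr rfl fun i _ => Finset.sum_congr rfl fun j _ => ?_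
  rw [sq, hs.apply i j]

theorem trace_nonneg_of_isSymm_idempotent {P : Matrix ι ι ℝ} (hs : P.IsSymm) (hi : P * P = P) :
    0 ≤ P.trace := by
  rw [← hi, trace_mul_self_eq_sum_sq hs]
  positivity

theorem eq_zero_of_isSymm_idempotent {P : Matrix ι ι ℝ} (hs : P.IsSymm) (hi : P * P = P)
    (h : P.trace = 0) : P = 0 := by
  rw [← hi, trace_mul_self_eq_sum_sq hs,
    Finset.sum_eq_zero_iff_of_nonneg fun i _ => by positivity] at h
  ext i j
  have := h i (Finset.mem_univ i)
  rw [Finset.sum_eq_zero_iff_of_nonneg fun i _ => by positivity] at this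
  simpa using this j (Finset.mem_univ j)

theorem trace_eq_rank_of_idempotent [DecidableEq ι] {P : Matrix ι ι ℝ} (hi : P * P = P) :
    P.trace = P.rank := by
  have h : IsIdempotentElem (toLin' P) := by
    rw [IsIdempotentElem, Module.End.mul_eq_comp, ← toLin'_mul, hi]
  have := (LinearMap.IsIdempotentElem.isProj_range _ h).trace
  rw [← Matrix.trace_toLin'_eq, this, Matrix.rank, ← Matrix.toLin'_apply']

/-- A symmetric idempotent of trace one is `p pᵀ` for a unit vector `p`. -/
theorem exists_eq_vecMulVec_of_trace_eq_one {P : Matrix ι ι ℝ} (hs : P.IsSymm) (hi : P * P = P)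
    (h : P.trace = 1) : ∃ p : ι → ℝ, p ⬝ᵥ p = 1 ∧ P = vecMulVec p p := by
  obtain ⟨b, hb⟩ : ∃ b, P b b ≠ 0 := by
    by_contra! hcon
    simp [trace, diag, hcon] at h
  have hbb : P b b = ∑ j, P j b * P j b := by
    conv_lhs => rw [← hi]
    rw [mul_apply]
    exact Finset.sum_congr rfl fun j _ => by rw [hs.apply b j]
  have hpos : 0 < P b b :=
    lt_of_le_of_ne (by rw [hbb]; exact Finset.sum_nonneg fun j _ => mul_self_nonneg _) hb.symm
  have hsq : √(P b b) * √(P b b) = P b b := Real.mul_self_sqrt hpos.le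
  have hs0 : √(P b b) ≠ 0 := (Real.sqrt_pos.2 hpos).ne'
  -- A nonzero column of `P`, normalized: its squared length is `(P²) b b = P b b`. The difference
  -- `P - p pᵀ` is then a symmetric idempotent of trace zero.
  let p : ι → ℝ := fun i => P i b / √(P b b)
  have hpp : p ⬝ᵥ p = 1 := by
    simp only [p, dotProduct, div_mul_div_comm, hsq, ← Finset.sum_div, ← hbb]
    exact div_self hb
  have hPp : P *ᵥ p = p := by
    ext i
    simp only [p, mulVec, dotProduct, ← mul_div_assoc, ← Finset.sum_div]
    rw [← mul_apply, hi]
  refine ⟨p, hpp, ?_⟩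
  have h1 : P * vecMulVec p p = vecMulVec p p := by rw [mul_vecMulVec, hPp]
  have h2 : vecMulVec p p * P = vecMulVec p p := by
    rw [vecMulVec_mul, ← mulVec_transpose, hs.eq, hPp]
  have hv : (vecMulVec p p) * vecMulVec p p = vecMulVec p p := by
    rw [vecMulVec_mul_vecMulVec, hpp, one_smul]
  have hvs : (vecMulVec p p).IsSymm := by
    ext i j; simp [vecMulVec_apply, mul_comm]
  refine sub_eq_zero.1 (eq_zero_of_isSymm_idempotent (hs.sub hvs) ?_ ?_)
  · rw [sub_mul, mul_sub, mul_sub, hi, h1, h2, hv]; abel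
  · rw [trace_sub, h, trace_vecMulVec, hpp, sub_self]

/-- An idempotent commuting with its transpose is symmetric. -/
theorem isSymm_of_commute_transpose {P : Matrix ι ι ℝ} (hi : P * P = P) (hc : Commute P Pᵀ) :
    P.IsSymm := by
  have hit : Pᵀ * Pᵀ = Pᵀ := by rw [← transpose_mul, hi]
  -- The vanishing of this Gram matrix gives `P = Pᵀ P`, whose right-hand side is symmetric.
  have h : (P - Pᵀ * P)ᵀ * (P - Pᵀ * P) = 0 := by
    have hc' : P * Pᵀ = Pᵀ * P := hc
    rw [transpose_sub, transpose_mul, transpose_transpose, sub_mul, mul_sub, mul_sub,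
      ← mul_assoc Pᵀ Pᵀ, hit, mul_assoc Pᵀ P P, hi, mul_assoc Pᵀ P (Pᵀ * P), ← mul_assoc P Pᵀ P, hc',
      mul_assoc Pᵀ P P, hi, ← mul_assoc Pᵀ Pᵀ P, hit]
    simp
  have h' : P - Pᵀ * P = 0 := by
    have := (Matrix.conjTranspose_mul_self_eq_zero (A := P - Pᵀ * P)).1
    rw [conjTranspose_eq_transpose_of_trivial] at this
    exact this h
  have h2 : P = Pᵀ * P := sub_eq_zero.1 h'
  rw [Matrix.IsSymm]
  conv_lhs => rw [h2]
  conv_rhs => rw [h2]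
  rw [transpose_mul, transpose_transpose]

end Projections

/-! ### Analytic matrix functions and spectral projectors. -/

section Rellich

open Matrix

variable {ι : Type*} [Fintype ι] [DecidableEq ι]

/-- A matrix function whose entries are analytic at `0`. -/
def EntryAnalytic (M : ℝ → Matrix ι ι ℝ) : Prop :=
  ∀ a b, AnalyticAt ℝ (fun ε => M ε a b) 0

namespace EntryAnalytic

omit [Fintype ι] [DecidableEq ι] in
theorem const (M : Matrix ι ι ℝ) : EntryAnalytic fun _ => M := fun _ _ => analyticAt_const

omit [Fintype ι] [DecidableEq ι] in
theorem add {M N : ℝ → Matrix ι ι ℝ} (hM : EntryAnalytic M) (hN : EntryAnalytic N) :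
    EntryAnalytic fun ε => M ε + N ε := fun a b => (hM a b).fun_add (hN a b)

omit [Fintype ι] [DecidableEq ι] in
theorem sub {M N : ℝ → Matrix ι ι ℝ} (hM : EntryAnalytic M) (hN : EntryAnalytic N) :
    EntryAnalytic fun ε => M ε - N ε := fun a b => (hM a b).fun_sub (hN a b)

omit [Fintype ι] [DecidableEq ι] in
theorem smul {c : ℝ → ℝ} {M : ℝ → Matrix ι ι ℝ} (hc : AnalyticAt ℝ c 0) (hM : EntryAnalytic M) :
    EntryAnalytic fun ε => c ε • M ε := fun a b => hc.fun_mul (hM a b)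

omit [DecidableEq ι] in
theorem mul {M N : ℝ → Matrix ι ι ℝ} (hM : EntryAnalytic M) (hN : EntryAnalytic N) :
    EntryAnalytic fun ε => M ε * N ε := fun a b => by
  simp only [mul_apply]
  exact Finset.analyticAt_fun_sum _ fun j _ => (hM a j).fun_mul (hN j b)

omit [DecidableEq ι] in
theorem trace {M : ℝ → Matrix ι ι ℝ} (hM : EntryAnalytic M) :
    AnalyticAt ℝ (fun ε => (M ε).trace) 0 :=
  Finset.analyticAt_fun_sum _ fun j _ => hM j j

theorem aeval {M : ℝ → Matrix ι ι ℝ} (hM : EntryAnalytic M) (g : ℝ[X]) :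
    EntryAnalytic fun ε => Polynomial.aeval (M ε) g := by
  induction g using Polynomial.induction_on' with
  | add p q hp hq => simpa only [map_add] using hp.add hq
  | monomial k c =>
    have hk : EntryAnalytic fun ε => M ε ^ k := by
      induction k with
      | zero => simpa only [pow_zero] using const 1
      | succ k ih => simpa only [pow_succ] using ih.mul hM
    simpa only [aeval_monomial, ← Algebra.smul_def] using smul analyticAt_const hk

omit [Fintype ι] [DecidableEq ι] in
/-- Two analytic matrix functions that agree frequently near `0` agree in a neighbourhood of
`0`. -/
theorem eventually_eq [Finite ι] {M N : ℝ → Matrix ι ι ℝ} (hM : EntryAnalytic M)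
    (hN : EntryAnalytic N) (h : ∃ᶠ ε in 𝓝[≠] 0, M ε = N ε) : ∀ᶠ ε in 𝓝 0, M ε = N ε := by
  have : ∀ᶠ ε in 𝓝 0, ∀ a b, M ε a b = N ε a b := by
    rw [eventually_all]
    intro a
    rw [eventually_all]
    intro b
    refine ((hM a b).frequently_eq_iff_eventually_eq (hN a b)).1 ?_
    exact h.mono fun ε hε => by rw [hε]
  filter_upwards [this] with ε hε
  ext a b
  exact hε a b

end EntryAnalytic

section Norm

attribute [local instance] Matrix.linftyOpNormedRing Matrix.linftyOpNormedAlgebra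

theorem EntryAnalytic.analyticAt {M : ℝ → Matrix ι ι ℝ} (hM : EntryAnalytic M) :
    AnalyticAt ℝ M 0 := by
  have h : M = fun ε => ∑ i, ∑ j, M ε i j • single i j (1 : ℝ) := by
    funext ε
    conv_lhs => rw [matrix_eq_sum_single (M ε)]
    simp
  rw [h]
  exact Finset.analyticAt_fun_sum _ fun i _ => Finset.analyticAt_fun_sum _ fun j _ =>
    (hM i j).fun_smul analyticAt_const

theorem entryAnalytic_of_analyticAt {M : ℝ → Matrix ι ι ℝ} (hM : AnalyticAt ℝ M 0) :
    EntryAnalytic M := fun a b => by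
  let L : Matrix ι ι ℝ →L[ℝ] ℝ := LinearMap.toContinuousLinearMap (entryLinearMap ℝ ℝ a b)
  exact (L.analyticAt (M 0)).fun_comp hM

/-- Correction of an analytic family of symmetric matrices that is idempotent at `0` to an analytic
family of symmetric idempotents. -/
theorem exists_entryAnalytic_idempotent {G : ℝ → Matrix ι ι ℝ} (hG : EntryAnalytic G)
    (hs : ∀ᶠ ε in 𝓝 0, (G ε).IsSymm) (h0 : G 0 * G 0 = G 0) :
    ∃ P : ℝ → Matrix ι ι ℝ, EntryAnalytic P ∧ P 0 = G 0 ∧ (∀ᶠ ε in 𝓝 0, P ε * P ε = P ε) ∧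
      (∀ᶠ ε in 𝓝 0, (P ε).IsSymm) ∧
      ∀ᶠ ε in 𝓝 0, ∀ c, Commute c (G ε) → Commute c (P ε) := by
  obtain ⟨P, hP, hP0, hi, hc⟩ := exists_analyticAt_idempotent hG.analyticAt h0
  refine ⟨P, entryAnalytic_of_analyticAt hP, hP0, hi, ?_, hc⟩
  filter_upwards [hs, hi, hc] with ε hs hi hc
  have h1 : Commute (P ε) (G ε) := (hc _ (Commute.refl _)).symm
  have h2 : Commute (P ε)ᵀ (G ε) := by
    have := congrArg transpose h1.eq
    rw [transpose_mul, transpose_mul, hs.eq] at this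
    exact this.symm
  exact isSymm_of_commute_transpose hi (hc _ h2).symm

/-- The leading coefficient of a matrix function that does not vanish identically near `0`. -/
theorem EntryAnalytic.exists_eq_pow_smul {M : ℝ → Matrix ι ι ℝ} (hM : EntryAnalytic M)
    (h : ¬ ∀ᶠ ε in 𝓝 0, M ε = 0) :
    ∃ (m : ℕ) (B : ℝ → Matrix ι ι ℝ), EntryAnalytic B ∧ B 0 ≠ 0 ∧
      ∀ᶠ ε in 𝓝 0, M ε = ε ^ m • B ε := by
  rw [← analyticOrderAt_eq_top, ← ne_eq, hM.analyticAt.analyticOrderAt_ne_top] at h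
  obtain ⟨B, hB, hB0, he⟩ := h
  exact ⟨_, B, entryAnalytic_of_analyticAt hB, hB0,
    he.mono fun ε h => by simpa using h⟩

end Norm

/-- A nonzero symmetric matrix has a nonzero eigenvalue, whose spectral projector is a polynomial
in the matrix. -/
theorem exists_spectral_projector {B : Matrix ι ι ℝ} (hB : B.IsSymm) (h0 : B ≠ 0) :
    ∃ (c : ℝ) (g : ℝ[X]), c ≠ 0 ∧ aeval B g * aeval B g = aeval B g ∧ aeval B g ≠ 0 ∧
      B * aeval B g = c • aeval B g := by
  have hsa : IsSelfAdjoint B := by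
    rw [IsSelfAdjoint, star_eq_conjTranspose, conjTranspose_eq_transpose_of_trivial, hB.eq]
  have hfin : (spectrum ℝ B).Finite := Matrix.finite_real_spectrum
  obtain ⟨c, hc, hc0⟩ : ∃ c ∈ spectrum ℝ B, c ≠ 0 := by
    by_contra! hcon
    apply h0
    rw [← cfc_id ℝ B hsa, cfc_congr (f := id) (g := fun _ => 0) fun x hx => hcon x hx]
    exact cfc_zero ..
  -- The indicator of `c` on the finite spectrum, interpolated by a polynomial so that it can also
  -- be evaluated at nearby members of an analytic family.
  let g : ℝ[X] := Lagrange.interpolate hfin.toFinset id (fun x => if x = c then 1 else 0)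
  have hg : ∀ x ∈ spectrum ℝ B, g.eval x = if x = c then 1 else 0 := fun x hx =>
    Lagrange.eval_interpolate_at_node _ (Function.injective_id.injOn) (hfin.mem_toFinset.2 hx)
  refine ⟨c, g, hc0, ?_, ?_, ?_⟩
  · rw [← cfc_polynomial g B hsa, ← cfc_mul ..]
    refine cfc_congr fun x hx => ?_
    simp only [hg x hx]
    split_ifs <;> simp
  · intro hz
    rw [← cfc_polynomial g B hsa] at hz
    have h1 : g.eval c ∈ spectrum ℝ (cfc (fun x => g.eval x) B) := by
      rw [cfc_map_spectrum (fun x => g.eval x) B]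
      exact ⟨c, hc, rfl⟩
    rw [hz, hg c hc, if_pos rfl, spectrum.mem_iff] at h1
    simp at h1
  · rw [← cfc_polynomial g B hsa]
    nth_rw 1 [← cfc_id ℝ B hsa]
    rw [← cfc_mul .., ← cfc_smul ..]
    refine cfc_congr fun x hx => ?_
    simp only [hg x hx]
    split_ifs with h <;> simp [h]

end Rellich

/-! ### Rellich's theorem by splitting invariant projectors. -/

section Rellich

open Matrix

variable {ι : Type*} [Fintype ι] [DecidableEq ι]

theorem Commute.aeval_right {R : Type*} [Ring R] [Algebra ℝ R] {a b : R} (h : Commute a b)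
    (g : ℝ[X]) : Commute a (aeval b g) := by
  induction g using Polynomial.induction_on' with
  | add p q hp hq => rw [map_add]; exact hp.add_right hq
  | monomial k d =>
    rw [aeval_monomial, ← Algebra.smul_def]
    exact (h.pow_right k).smul_right d

theorem Matrix.IsSymm.aeval {B : Matrix ι ι ℝ} (h : B.IsSymm) (g : ℝ[X]) :
    (Polynomial.aeval B g).IsSymm := by
  induction g using Polynomial.induction_on' with
  | add p q hp hq => rw [map_add]; exact hp.add hq
  | monomial k d =>
    rw [aeval_monomial, ← Algebra.smul_def]
    exact (h.pow k).smul d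

/-- An analytic family of orthogonal projectors commuting with the family `A`. -/
structure IsInvariantProj (A P : ℝ → Matrix ι ι ℝ) : Prop where
  analytic : EntryAnalytic P
  isSymm : ∀ᶠ ε in 𝓝 0, (P ε).IsSymm
  idem : ∀ᶠ ε in 𝓝 0, P ε * P ε = P ε
  comm : ∀ᶠ ε in 𝓝 0, Commute (A ε) (P ε)

/-- The trace of an idempotent is its rank, so it is an integer that depends continuously on `ε`,
hence locally constant. -/
theorem IsInvariantProj.trace_eventually_eq {A P : ℝ → Matrix ι ι ℝ} (h : IsInvariantProj A P) :
    ∀ᶠ ε in 𝓝 0, (P ε).trace = (P 0).trace := by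
  have hc := h.analytic.trace.continuousAt.tendsto
  have h0 := trace_eq_rank_of_idempotent h.idem.self_of_nhds
  have := hc.eventually (Metric.ball_mem_nhds _ one_pos)
  filter_upwards [this, h.idem] with ε h1 h2
  rw [trace_eq_rank_of_idempotent h2, h0, Real.dist_eq] at h1
  rw [trace_eq_rank_of_idempotent h2, h0]
  have h3 : |((P ε).rank : ℤ) - (P 0).rank| < 1 := by exact_mod_cast h1
  rw [Int.abs_lt_one_iff, sub_eq_zero] at h3
  exact_mod_cast h3

/-- If `A` acts as a scalar on the range of `P`, then a rank-one projector splits off. -/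
theorem IsInvariantProj.exists_split_of_scalar {A P : ℝ → Matrix ι ι ℝ} {c : ℝ → ℝ}
    (h : IsInvariantProj A P) (hA : ∀ᶠ ε in 𝓝 0, A ε * P ε = c ε • P ε)
    (hr : 1 < (P 0).trace) :
    ∃ P₁ : ℝ → Matrix ι ι ℝ, IsInvariantProj A P₁ ∧ (∀ᶠ ε in 𝓝 0, P ε * P₁ ε = P₁ ε) ∧
      (∀ᶠ ε in 𝓝 0, P₁ ε * P ε = P₁ ε) ∧ 0 < (P₁ 0).trace ∧ (P₁ 0).trace < (P 0).trace := by
  obtain ⟨b, hb⟩ : ∃ b, P 0 b b ≠ 0 := by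
    by_contra! hcon
    simp only [trace, diag, hcon, Finset.sum_const_zero] at hr
    linarith
  have hb' : ∀ᶠ ε in 𝓝 0, P ε b b ≠ 0 :=
    (h.analytic b b).continuousAt.tendsto.eventually_ne hb
  -- With `v` the `b`-th column of `P`, this is `v vᵀ` and `v · v = P b b`. Any line in the range of
  -- `P` is invariant under the scalar action, so dividing by `P b b` yields an admissible rank-one
  -- projector.
  let S : ℝ → Matrix ι ι ℝ := fun ε => P ε * single b b (1 : ℝ) * P ε
  have hSS : ∀ ε, P ε * P ε = P ε → S ε * S ε = P ε b b • S ε := by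
    intro ε hi
    have : single b b (1 : ℝ) * P ε * single b b (1 : ℝ) = P ε b b • single b b (1 : ℝ) := by
      rw [single_mul_mul_single, smul_single]
      simp
    calc S ε * S ε = P ε * (single b b (1 : ℝ) * (P ε * P ε) * single b b (1 : ℝ)) * P ε := by
          simp only [S, mul_assoc]
      _ = _ := by rw [hi, this, mul_smul_comm, smul_mul_assoc]
  have htr : ∀ ε, P ε * P ε = P ε → (S ε).trace = P ε b b := by
    intro ε hi
    simp only [S]
    rw [trace_mul_comm, ← mul_assoc, hi, trace_mul_single]
    simp
  have hPS : ∀ ε, P ε * P ε = P ε → P ε * S ε = S ε := by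
    intro ε hi
    simp only [S]
    rw [← mul_assoc, ← mul_assoc, hi]
  have hSP : ∀ ε, P ε * P ε = P ε → S ε * P ε = S ε := by
    intro ε hi
    simp only [S]
    rw [mul_assoc, hi]
  have ht0 : ((P 0 b b)⁻¹ • S 0).trace = 1 := by
    rw [trace_smul, htr 0 h.idem.self_of_nhds, smul_eq_mul, inv_mul_cancel₀ hb]
  refine ⟨fun ε => (P ε b b)⁻¹ • S ε, ⟨?_, ?_, ?_, ?_⟩, ?_, ?_, ?_, ?_⟩
  · exact EntryAnalytic.smul ((h.analytic b b).fun_inv hb)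
      ((h.analytic.mul (EntryAnalytic.const _)).mul h.analytic)
  · filter_upwards [h.isSymm] with ε hs
    refine IsSymm.smul ?_ _
    simp only [S]
    rw [IsSymm, transpose_mul, transpose_mul, hs.eq, transpose_single, mul_assoc]
  · filter_upwards [h.idem, hb'] with ε hi hb'
    rw [smul_mul_smul_comm, hSS ε hi, smul_smul, mul_assoc, inv_mul_cancel₀ hb', mul_one]
  · filter_upwards [h.idem, hA, h.comm] with ε hi hA hc
    refine Commute.smul_right ?_ _
    have h1 : P ε * A ε = c ε • P ε := hc.eq ▸ hA
    show A ε * (P ε * _ * P ε) = P ε * _ * P ε * A ε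
    rw [mul_assoc (P ε * _), h1, ← mul_assoc, ← mul_assoc, hA]
    simp
  · filter_upwards [h.idem] with ε hi
    rw [mul_smul_comm, hPS ε hi]
  · filter_upwards [h.idem] with ε hi
    rw [smul_mul_assoc, hSP ε hi]
  · simp only [ht0]; exact one_pos
  · simpa only [ht0] using hr

/-- An analytic family of symmetric matrices, nonzero and with zero trace at `0`, living on the range
of `P`, splits `P`. -/
theorem IsInvariantProj.exists_split_of_ne_zero {A P B : ℝ → Matrix ι ι ℝ}
    (h : IsInvariantProj A P) (hB : EntryAnalytic B) (hBs : ∀ᶠ ε in 𝓝 0, (B ε).IsSymm)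
    (hPB : ∀ᶠ ε in 𝓝 0, P ε * B ε = B ε) (hBP : ∀ᶠ ε in 𝓝 0, B ε * P ε = B ε)
    (hAB : ∀ᶠ ε in 𝓝 0, Commute (A ε) (B ε)) (hB0 : B 0 ≠ 0) (hBt : (B 0).trace = 0)
    (hr : 0 < (P 0).trace) :
    ∃ P₁ : ℝ → Matrix ι ι ℝ, IsInvariantProj A P₁ ∧ (∀ᶠ ε in 𝓝 0, P ε * P₁ ε = P₁ ε) ∧
      (∀ᶠ ε in 𝓝 0, P₁ ε * P ε = P₁ ε) ∧ 0 < (P₁ 0).trace ∧ (P₁ 0).trace < (P 0).trace := by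
  obtain ⟨c, g, hc0, hE, hE0, hBE⟩ := exists_spectral_projector hBs.self_of_nhds hB0
  -- The polynomial `g` is fixed by `B 0`. Consequently `g (B ε)` is known to be idempotent only at
  -- `0` and has to be corrected.
  obtain ⟨R, hR, hR0, hRi, hRs, hRc⟩ := exists_entryAnalytic_idempotent (hB.aeval g)
    (hBs.mono fun ε hs => hs.aeval g) hE
  have hRc' : ∀ᶠ ε in 𝓝 0, ∀ M, Commute M (B ε) → Commute M (R ε) := by
    filter_upwards [hRc] with ε hRc M hM
    exact hRc M (hM.aeval_right g)
  have hRP : ∀ᶠ ε in 𝓝 0, Commute (P ε) (R ε) := by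
    filter_upwards [hRc', hPB, hBP] with ε h1 h2 h3
    exact h1 _ (h2.trans h3.symm)
  have hPE : P 0 * R 0 = R 0 := by
    have h1 : R 0 = c⁻¹ • (B 0 * R 0) := by
      rw [hR0, hBE, smul_smul, inv_mul_cancel₀ hc0, one_smul]
    rw [h1, mul_smul_comm, ← mul_assoc, hPB.self_of_nhds]
  have hP1 : IsInvariantProj A fun ε => P ε * R ε := by
    refine ⟨h.analytic.mul hR, ?_, ?_, ?_⟩
    · filter_upwards [h.isSymm, hRs, hRP] with ε h1 h2 h3
      rw [IsSymm, transpose_mul, h1.eq, h2.eq, h3.eq]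
    · filter_upwards [h.idem, hRi, hRP] with ε h1 h2 h3
      rw [h3.symm.mul_mul_mul_comm, h1, h2]
    · filter_upwards [h.comm, hRc', hAB] with ε h1 h2 h3
      exact h1.mul_right (h2 _ h3)
  refine ⟨fun ε => P ε * R ε, hP1, ?_, ?_, ?_, ?_⟩
  · filter_upwards [h.idem] with ε h1
    rw [← mul_assoc, h1]
  · filter_upwards [h.idem, hRP] with ε h1 h2
    rw [mul_assoc, ← h2.eq, ← mul_assoc, h1]
  · simp only [hPE]
    refine lt_of_le_of_ne (trace_nonneg_of_isSymm_idempotent hRs.self_of_nhds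
      hRi.self_of_nhds) fun ht => hE0 ?_
    rw [← hR0]
    exact eq_zero_of_isSymm_idempotent hRs.self_of_nhds hRi.self_of_nhds ht.symm
  · simp only [hPE]
    have hEP : R 0 * P 0 = R 0 := by rw [← hRP.self_of_nhds.eq, hPE]
    have hds : (P 0 - R 0).IsSymm := h.isSymm.self_of_nhds.sub hRs.self_of_nhds
    have hdi : (P 0 - R 0) * (P 0 - R 0) = P 0 - R 0 := by
      rw [sub_mul, mul_sub, mul_sub, h.idem.self_of_nhds, hRi.self_of_nhds, hPE, hEP, sub_self,
        sub_zero]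
    rw [← sub_pos, ← trace_sub]
    refine lt_of_le_of_ne (trace_nonneg_of_isSymm_idempotent hds hdi) fun ht => ?_
    have hz := sub_eq_zero.1 (eq_zero_of_isSymm_idempotent hds hdi ht.symm)
    -- If the spectral projector were all of `P 0`, then `B 0` would be a nonzero multiple of `P 0`,
    -- contradicting its zero trace.
    have hBc : B 0 = c • P 0 := by
      rw [← hBP.self_of_nhds, hz, hR0, hBE]
    rw [hBc, trace_smul, smul_eq_mul] at hBt
    exact (mul_ne_zero hc0 hr.ne') hBt

/-- An invariant projector of rank at least two can be split. -/
theorem IsInvariantProj.exists_split {A P : ℝ → Matrix ι ι ℝ} (h : IsInvariantProj A P)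
    (hA : EntryAnalytic A) (hAs : ∀ᶠ ε in 𝓝 0, (A ε).IsSymm) (hr : 1 < (P 0).trace) :
    ∃ P₁ : ℝ → Matrix ι ι ℝ, IsInvariantProj A P₁ ∧ (∀ᶠ ε in 𝓝 0, P ε * P₁ ε = P₁ ε) ∧
      (∀ᶠ ε in 𝓝 0, P₁ ε * P ε = P₁ ε) ∧ 0 < (P₁ 0).trace ∧ (P₁ 0).trace < (P 0).trace := by
  -- The mean of the eigenvalues of `A` on the range of `P`. Subtracting it makes `D` traceless, so
  -- the leading coefficient of `D`, if there is one, is a nonzero traceless matrix and has a proper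
  -- spectral projector inside `P 0`.
  let c : ℝ → ℝ := fun ε => (A ε * P ε).trace * (P 0).trace⁻¹
  have hcA : AnalyticAt ℝ c 0 := (hA.mul h.analytic).trace.fun_mul analyticAt_const
  let D : ℝ → Matrix ι ι ℝ := fun ε => A ε * P ε - c ε • P ε
  have hD : EntryAnalytic D := (hA.mul h.analytic).sub (EntryAnalytic.smul hcA h.analytic)
  have hr0 : (P 0).trace ≠ 0 := by linarith
  by_cases hz : ∀ᶠ ε in 𝓝 0, D ε = 0
  · exact h.exists_split_of_scalar (c := c) (hz.mono fun ε hε => sub_eq_zero.1 hε) hr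
  · obtain ⟨m, B, hB, hB0, hDB⟩ := hD.exists_eq_pow_smul hz
    -- The algebraic properties of `B` are read off from `D` for `ε ≠ 0` and carried over to `ε = 0`
    -- by the identity principle.
    have hDB' : ∀ᶠ ε in 𝓝[≠] 0, B ε = (ε ^ m)⁻¹ • D ε := by
      filter_upwards [hDB.filter_mono nhdsWithin_le_nhds, self_mem_nhdsWithin] with ε h1 h2
      rw [h1, smul_smul, inv_mul_cancel₀ (pow_ne_zero _ h2), one_smul]
    have le : 𝓝[≠] (0 : ℝ) ≤ 𝓝 0 := nhdsWithin_le_nhds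
    have hBs : ∀ᶠ ε in 𝓝 0, (B ε).IsSymm := by
      refine EntryAnalytic.eventually_eq (M := fun ε => (B ε)ᵀ) (fun a b => hB b a) hB (Eventually.frequently ?_)
      filter_upwards [hDB', hAs.filter_mono le, h.isSymm.filter_mono le, h.comm.filter_mono le]
        with ε h1 h2 h3 h4
      rw [h1]
      refine IsSymm.smul (IsSymm.sub ?_ (h3.smul _)) _
      rw [IsSymm, transpose_mul, h2.eq, h3.eq, h4.eq]
    have hPB : ∀ᶠ ε in 𝓝 0, P ε * B ε = B ε := by
      refine EntryAnalytic.eventually_eq (h.analytic.mul hB) hB (Eventually.frequently ?_)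
      filter_upwards [hDB', h.idem.filter_mono le, h.comm.filter_mono le] with ε h1 h2 h3
      rw [h1, mul_smul_comm, mul_sub, mul_smul_comm, h2, ← mul_assoc, ← h3.eq, mul_assoc, h2]
    have hBP : ∀ᶠ ε in 𝓝 0, B ε * P ε = B ε := by
      refine EntryAnalytic.eventually_eq (hB.mul h.analytic) hB (Eventually.frequently ?_)
      filter_upwards [hDB', h.idem.filter_mono le] with ε h1 h2
      rw [h1, smul_mul_assoc, sub_mul, smul_mul_assoc, h2, mul_assoc, h2]
    have hAB : ∀ᶠ ε in 𝓝 0, A ε * B ε = B ε * A ε := by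
      refine EntryAnalytic.eventually_eq (hA.mul hB) (hB.mul hA) (Eventually.frequently ?_)
      filter_upwards [hDB', h.comm.filter_mono le] with ε h1 h2
      rw [h1]
      exact ((((Commute.refl _).mul_right h2).sub_right (h2.smul_right _)).smul_right _).eq
    have hBt : (B 0).trace = 0 := by
      have : ∀ᶠ ε in 𝓝[≠] 0, (B ε).trace = 0 := by
        filter_upwards [hDB', h.trace_eventually_eq.filter_mono le] with ε h1 h2
        rw [h1, trace_smul, trace_sub, trace_smul, h2]
        simp [c, mul_assoc, inv_mul_cancel₀ hr0]
      exact ((hB.trace.frequently_eq_iff_eventually_eq analyticAt_const).1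
        this.frequently).self_of_nhds
    exact h.exists_split_of_ne_zero hB hBs hPB hBP hAB hB0 hBt (by linarith)

/-- Decomposition of an invariant projector into invariant projectors of rank one. -/
theorem IsInvariantProj.exists_decomposition {A : ℝ → Matrix ι ι ℝ} (hA : EntryAnalytic A)
    (hAs : ∀ᶠ ε in 𝓝 0, (A ε).IsSymm) (r : ℕ) :
    ∀ P : ℝ → Matrix ι ι ℝ, IsInvariantProj A P → (P 0).trace = r →
      ∃ (κ : Type) (_ : Fintype κ) (T : κ → ℝ → Matrix ι ι ℝ), Fintype.card κ = r ∧
        (∀ j, IsInvariantProj A (T j) ∧ (T j 0).trace = 1) ∧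
        (∀ i j, i ≠ j → ∀ᶠ ε in 𝓝 0, T i ε * T j ε = 0) ∧
        ∀ᶠ ε in 𝓝 0, P ε = ∑ j, T j ε := by
  induction r using Nat.strong_induction_on with
  | _ r ih =>
    intro P hP hr
    rcases Nat.lt_or_ge 1 r with h1 | h1
    · have h1' : 1 < (P 0).trace := by rw [hr]; exact_mod_cast h1
      obtain ⟨P₁, hP₁, hPP₁, hP₁P, h0, hlt⟩ := hP.exists_split hA hAs h1'
      have hP₂ : IsInvariantProj A fun ε => P ε - P₁ ε := by
        refine ⟨hP.analytic.sub hP₁.analytic, ?_, ?_, ?_⟩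
        · filter_upwards [hP.isSymm, hP₁.isSymm] with ε h1 h2 using h1.sub h2
        · filter_upwards [hP.idem, hP₁.idem, hPP₁, hP₁P] with ε h1 h2 h3 h4
          rw [sub_mul, mul_sub, mul_sub, h1, h2, h3, h4, sub_self, sub_zero]
        · filter_upwards [hP.comm, hP₁.comm] with ε h1 h2 using h1.sub_right h2
      have ht1 := trace_eq_rank_of_idempotent hP₁.idem.self_of_nhds
      set r₁ := (P₁ 0).rank
      rw [ht1] at h0 hlt
      rw [hr] at hlt
      have h0' : 0 < r₁ := by exact_mod_cast h0
      have hlt' : r₁ < r := by exact_mod_cast hlt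
      obtain ⟨κ₁, _, T₁, hc₁, hT₁, ho₁, hs₁⟩ := ih r₁ hlt' P₁ hP₁ ht1
      obtain ⟨κ₂, _, T₂, hc₂, hT₂, ho₂, hs₂⟩ := ih (r - r₁) (by omega) _ hP₂ (by
        simp only [trace_sub]
        rw [hr, ht1, Nat.cast_sub hlt'.le])
      have hl : ∀ i, ∀ᶠ ε in 𝓝 0, T₁ i ε * P₁ ε = T₁ i ε := by
        intro i
        have : ∀ᶠ ε in 𝓝 0, ∀ j, i ≠ j → T₁ i ε * T₁ j ε = 0 :=
          eventually_all.2 fun j => by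
            by_cases hij : i = j
            · exact .of_forall fun ε h => absurd hij h
            · exact (ho₁ i j hij).mono fun ε h _ => h
        filter_upwards [this, (hT₁ i).1.idem, hs₁] with ε h1 h2 h3
        rw [h3, Finset.mul_sum, Finset.sum_eq_single i (fun j _ hj => h1 j hj.symm) (by simp), h2]
      have hl2 : ∀ i, ∀ᶠ ε in 𝓝 0, (P ε - P₁ ε) * T₂ i ε = T₂ i ε := by
        intro i
        have : ∀ᶠ ε in 𝓝 0, ∀ j, j ≠ i → T₂ j ε * T₂ i ε = 0 :=
          eventually_all.2 fun j => by
            by_cases hij : j = i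
            · exact .of_forall fun ε h => absurd hij h
            · exact (ho₂ j i hij).mono fun ε h _ => h
        filter_upwards [this, (hT₂ i).1.idem, hs₂] with ε h1 h2 h3
        rw [h3, Finset.sum_mul, Finset.sum_eq_single i (fun j _ hj => h1 j hj) (by simp), h2]
      have h12 : ∀ i j, ∀ᶠ ε in 𝓝 0, T₁ i ε * T₂ j ε = 0 := by
        intro i j
        filter_upwards [hl i, hl2 j, hP₁P, hP₁.idem] with ε h1 h2 h3 h4
        rw [← h1, ← h2, mul_assoc, ← mul_assoc (P₁ ε), mul_sub, h3, h4, sub_self, zero_mul,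
          mul_zero]
      refine ⟨κ₁ ⊕ κ₂, inferInstance, Sum.elim T₁ T₂, ?_, ?_, ?_, ?_⟩
      · rw [Fintype.card_sum, hc₁, hc₂]; omega
      · rintro (j | j)
        · exact hT₁ j
        · exact hT₂ j
      · rintro (i | i) (j | j) hij
        · exact ho₁ i j (by simpa using hij)
        · exact h12 i j
        · filter_upwards [h12 j i, (hT₁ j).1.isSymm, (hT₂ i).1.isSymm] with ε h1 h2 h3
          have := congrArg transpose h1
          rwa [transpose_mul, h2.eq, h3.eq, transpose_zero] at this
        · exact ho₂ i j (by simpa using hij)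
      · filter_upwards [hs₁, hs₂] with ε h1 h2
        simp only [Fintype.sum_sum_type, Sum.elim_inl, Sum.elim_inr]
        rw [← h1, ← h2, add_sub_cancel]
    · interval_cases r
      · refine ⟨Empty, inferInstance, Empty.elim, rfl, fun j => j.elim, fun j => j.elim, ?_⟩
        filter_upwards [hP.isSymm, hP.idem, hP.trace_eventually_eq] with ε h1 h2 h3
        simp only [Finset.univ_eq_empty, Finset.sum_empty]
        exact eq_zero_of_isSymm_idempotent h1 h2 (by rw [h3, hr]; simp)
      · refine ⟨Unit, inferInstance, fun _ => P, rfl, fun _ => ⟨hP, by simpa using hr⟩, ?_, ?_⟩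
        · intro i j hij
          exact absurd (Subsingleton.elim i j) hij
        · simp

/-- Rellich's theorem: an analytic family of real symmetric matrices has an analytic eigenvalue
decomposition. -/
theorem exists_isAnalyticEVD {n : ℕ} {A : ℝ → Matrix (Fin n) (Fin n) ℝ} (hA : EntryAnalytic A)
    (hAs : ∀ᶠ ε in 𝓝 0, (A ε).IsSymm) : ∃ lam P, IsAnalyticEVD A lam P := by
  have h1 : IsInvariantProj A fun _ => 1 :=
    ⟨EntryAnalytic.const 1, .of_forall fun _ => isSymm_one, .of_forall fun _ => one_mul 1,
      .of_forall fun ε => Commute.one_right (A ε)⟩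
  obtain ⟨κ, _, T, hc, hT, ho, hs⟩ :=
    IsInvariantProj.exists_decomposition hA hAs n _ h1 (by simp)
  let e : Fin n ≃ κ := (Fintype.equivFinOfCardEq hc).symm
  -- On the range of a commuting rank-one projector `T`, the matrix `A` acts as the scalar `trace (A
  -- T)`, which is visibly analytic.
  refine ⟨fun j ε => (A ε * T (e j) ε).trace, fun j => T (e j),
    fun j => (hA.mul (hT _).1.analytic).trace, fun j => (hT _).1.analytic,
    eventually_all.2 fun j => (hT _).1.isSymm, eventually_all.2 fun j => (hT _).1.idem,
    eventually_all.2 fun j => ?_, ?_, ?_⟩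
  · filter_upwards [(hT (e j)).1.idem, (hT (e j)).1.trace_eventually_eq] with ε h1 h2
    have := trace_eq_rank_of_idempotent h1
    rw [h2, (hT _).2] at this
    exact_mod_cast this.symm
  · refine eventually_all.2 fun i => eventually_all.2 fun j => ?_
    by_cases hij : i = j
    · exact .of_forall fun ε h => absurd hij h
    · exact (ho _ _ (e.injective.ne hij)).mono fun ε h _ => h
  · have : ∀ᶠ ε in 𝓝 0, ∀ j, A ε * T (e j) ε = (A ε * T (e j) ε).trace • T (e j) ε := by
      refine eventually_all.2 fun j => ?_
      filter_upwards [(hT (e j)).1.idem, (hT (e j)).1.trace_eventually_eq, (hT (e j)).1.isSymm,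
        (hT (e j)).1.comm] with ε h1 h2 h3 h4
      rw [(hT _).2] at h2
      have h5 : A ε * T (e j) ε = T (e j) ε * A ε * T (e j) ε := by
        rw [← h4.eq, mul_assoc, h1]
      obtain ⟨p, hp, hP⟩ := exists_eq_vecMulVec_of_trace_eq_one h3 h1 h2
      rw [h5, hP, vecMulVec_mul, vecMulVec_mul_vecMulVec, vecMulVec_smul, trace_smul,
        trace_vecMulVec, hp, smul_eq_mul, mul_one]
    filter_upwards [hs, this] with ε h1 h2
    calc A ε = A ε * ∑ j, T j ε := by rw [← h1, mul_one]
      _ = ∑ j, A ε * T (e j) ε := by rw [Finset.mul_sum, ← e.sum_comp]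
      _ = _ := Finset.sum_congr rfl fun j _ => h2 j

end Rellich

/-! ### Multivariate Taylor expansion along rays. -/

section Taylor

variable {d : ℕ}

/-- A function on `ℝ^d` with continuous partial derivatives is differentiable. -/
theorem hasFDerivAt_of_continuousOn_partial {Ω : Set (Fin d → ℝ)} (hΩ : IsOpen Ω)
    {f : (Fin d → ℝ) → ℝ} {f' : Fin d → (Fin d → ℝ) → ℝ}
    (hf : ∀ l, ∀ x ∈ Ω, HasLineDerivAt ℝ f (f' l x) x (Pi.single l 1))
    (hc : ∀ l, ContinuousOn (f' l) Ω) {x : Fin d → ℝ} (hx : x ∈ Ω) :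
    HasFDerivAt f (∑ l, f' l x • ContinuousLinearMap.proj (R := ℝ) (φ := fun _ : Fin d => ℝ) l)
      x := by
  rw [hasFDerivAt_iff_isLittleO_nhds_zero, isLittleO_iff]
  intro c hc0
  obtain ⟨δ, hδ0, hδ⟩ : ∃ δ : ℝ, 0 < δ ∧ d * δ ≤ c :=
    ⟨c / (d + 1), by positivity, by
      rw [mul_div_assoc', div_le_iff₀ (by positivity)]; nlinarith⟩
  have hev : ∀ᶠ y in 𝓝 x, y ∈ Ω ∧ ∀ l, |f' l y - f' l x| ≤ δ := by
    refine Filter.Eventually.and (hΩ.mem_nhds hx) (eventually_all.2 fun l => ?_)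
    have := ((hc l).continuousAt (hΩ.mem_nhds hx)).tendsto
    filter_upwards [this (Metric.closedBall_mem_nhds _ hδ0)] with y hy
    simpa [Real.dist_eq] using hy
  obtain ⟨ρ, hρ0, hρ⟩ := Metric.eventually_nhds_iff_ball.1 hev
  filter_upwards [Metric.ball_mem_nhds (0 : Fin d → ℝ) hρ0] with h hh
  have hh' : ‖h‖ < ρ := by simpa using hh
  -- The increment `h` is built up one coordinate at a time; each insertion costs at most `δ ‖h‖` by
  -- the mean value inequality.
  have key : ∀ S : Finset (Fin d),
      |f (x + ∑ l ∈ S, Pi.single l (h l)) - f x - ∑ l ∈ S, f' l x * h l| ≤ S.card * δ * ‖h‖ := by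
    intro S
    induction S using Finset.induction_on with
    | empty => simp
    | insert a S ha ih =>
      set y := x + ∑ l ∈ S, Pi.single l (h l) with hy
      have hmem : ∀ r ∈ Set.uIcc 0 (h a), y + r • Pi.single a (1 : ℝ) ∈ Metric.ball x ρ := by
        intro r hr
        have hra : |r| ≤ |h a| := by simpa using Set.abs_sub_left_of_mem_uIcc hr
        rw [Metric.mem_ball, dist_eq_norm]
        refine lt_of_le_of_lt ?_ hh'
        rw [pi_norm_le_iff_of_nonneg (norm_nonneg h)]
        intro i
        have h1 : (y + r • Pi.single a (1 : ℝ) - x : Fin d → ℝ) i =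
            (if i ∈ S then h i else 0) + if i = a then r else 0 := by
          simp [hy, Finset.sum_apply, Pi.single_apply, add_assoc, add_comm]
        rw [h1]
        by_cases hi : i = a
        · subst hi
          simp only [ha, if_false, if_true, zero_add]
          exact hra.trans (norm_le_pi_norm h i)
        · by_cases hiS : i ∈ S
          · simpa [hi, hiS] using norm_le_pi_norm h i
          · simp [hi, hiS]
      -- The linear part is subtracted first, so that the derivative along the segment is bounded by
      -- `δ`.
      have hder : ∀ r ∈ Set.uIcc 0 (h a), HasDerivWithinAt
          (fun r => f (y + r • Pi.single a (1 : ℝ)) - r * f' a x)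
          (f' a (y + r • Pi.single a (1 : ℝ)) - f' a x) (Set.uIcc 0 (h a)) r := by
        intro r hr
        have h1 := hf a _ (hρ _ (hmem r hr)).1
        have h2 : HasDerivAt (fun t => f (y + r • Pi.single a (1 : ℝ) + t • Pi.single a (1 : ℝ)))
          (f' a (y + r • Pi.single a (1 : ℝ))) (r - r) := by rw [sub_self]; exact h1
        have h3 := h2.comp_sub_const r r
        have h4 : (fun t => f (y + r • Pi.single a (1 : ℝ) + (t - r) • Pi.single a (1 : ℝ))) =
            fun t => f (y + t • Pi.single a (1 : ℝ)) := by
          funext t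
          congr 1
          module
        rw [h4] at h3
        have h5 := h3.sub ((hasDerivAt_id r).mul_const (f' a x))
        rw [one_mul] at h5
        exact h5.hasDerivWithinAt
      have hmv := Convex.norm_image_sub_le_of_norm_hasDerivWithin_le hder
        (fun r hr => (hρ _ (hmem r hr)).2 a) (convex_uIcc 0 (h a)) Set.left_mem_uIcc
        Set.right_mem_uIcc
      have hsing : h a • Pi.single a (1 : ℝ) = (Pi.single a (h a) : Fin d → ℝ) := by
        rw [← Pi.single_smul, smul_eq_mul, mul_one]
      rw [hsing, zero_smul, add_zero, zero_mul, sub_zero, sub_zero] at hmv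
      have hha : ‖h a‖ ≤ ‖h‖ := norm_le_pi_norm h a
      have hsum : x + ∑ l ∈ insert a S, Pi.single l (h l) = y + Pi.single a (h a) := by
        rw [Finset.sum_insert ha, hy]; abel
      rw [hsum, Finset.sum_insert ha, Finset.card_insert_of_notMem ha]
      calc |f (y + Pi.single a (h a)) - f x - (f' a x * h a + ∑ l ∈ S, f' l x * h l)|
          = |(f (y + Pi.single a (h a)) - h a * f' a x - f y) +
              (f y - f x - ∑ l ∈ S, f' l x * h l)| := by congr 1; ring
        _ ≤ δ * ‖h a‖ + S.card * δ * ‖h‖ := (abs_add_le _ _).trans (add_le_add hmv ih)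
        _ ≤ δ * ‖h‖ + S.card * δ * ‖h‖ := by gcongr
        _ = _ := by push_cast; ring
  have := key Finset.univ
  rw [Finset.univ_sum_single, Finset.card_univ, Fintype.card_fin] at this
  simp only [sum_apply, smul_apply,
    ContinuousLinearMap.proj_apply, smul_eq_mul, Real.norm_eq_abs]
  exact this.trans (by gcongr)

theorem mem_degEq {s : ℕ} {α : Fin d → ℕ} : α ∈ degEq d s ↔ mdeg α = s := by
  simp [degEq, mdeg, Finset.mem_piAntidiag]

theorem mem_degLT {s : ℕ} {α : Fin d → ℕ} : α ∈ degLT d s ↔ mdeg α < s := by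
  simp [degLT, mem_degEq]

theorem mdeg_add_single (α : Fin d → ℕ) (l : Fin d) : mdeg (α + Pi.single l 1) = mdeg α + 1 := by
  simp [mdeg, Finset.sum_add_distrib]

/-- The coefficient `v^γ / γ!` of a Taylor expansion. -/
noncomputable def taylorCoeff (v : Fin d → ℝ) (γ : Fin d → ℕ) : ℝ :=
  (∏ l, v l ^ γ l) / mfact γ

theorem mfact_ne_zero (γ : Fin d → ℕ) : (mfact γ : ℝ) ≠ 0 := by
  rw [mfact]
  exact_mod_cast Finset.prod_ne_zero_iff.2 fun l _ => (γ l).factorial_ne_zero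

theorem taylorCoeff_add_single (v : Fin d → ℝ) (γ : Fin d → ℕ) (l : Fin d) :
    (((γ + Pi.single l 1 : Fin d → ℕ) l : ℕ) : ℝ) * taylorCoeff v (γ + Pi.single l 1) = taylorCoeff v γ * v l := by
  have h1 : ∏ i, v i ^ (γ + Pi.single l 1 : Fin d → ℕ) i = (∏ i, v i ^ γ i) * v l := by
    simp only [Pi.add_apply, pow_add, Finset.prod_mul_distrib]
    congr 1
    rw [Finset.prod_eq_single l] <;> simp +contextual
  have h2 : mfact (γ + Pi.single l 1) = mfact γ * (γ l + 1) := by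
    simp only [mfact]
    rw [← Finset.mul_prod_erase _ _ (Finset.mem_univ l),
      ← Finset.mul_prod_erase _ (fun i => (γ i).factorial) (Finset.mem_univ l)]
    have : ∏ i ∈ Finset.univ.erase l, ((γ + Pi.single l 1 : Fin d → ℕ) i).factorial =
        ∏ i ∈ Finset.univ.erase l, (γ i).factorial := by
      refine Finset.prod_congr rfl fun i hi => ?_
      simp [Finset.ne_of_mem_erase hi]
    rw [this]
    simp only [Pi.add_apply, Pi.single_eq_same, Nat.factorial_succ]
    ring
  have h3 := mfact_ne_zero γ
  have h4 : (γ l : ℝ) + 1 ≠ 0 := by positivity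
  rw [taylorCoeff, taylorCoeff, h1, h2]
  push_cast
  simp only [Pi.add_apply, Pi.single_eq_same]
  push_cast
  field_simp

/-- A multi-index `γ` of degree `p + 1` is reached from `γ - e_l` with weight `γ l`, and these
weights add up to `p + 1`. -/
theorem sum_taylorCoeff_succ (v : Fin d → ℝ) (p : ℕ) (F : (Fin d → ℕ) → ℝ) :
    ∑ γ ∈ degEq d p, taylorCoeff v γ * ∑ l, F (γ + Pi.single l 1) * v l =
      (p + 1) * ∑ γ ∈ degEq d (p + 1), taylorCoeff v γ * F γ := by
  have h1 : ∀ γ ∈ degEq d (p + 1), (p + 1 : ℝ) * (taylorCoeff v γ * F γ) =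
      ∑ l, γ l * taylorCoeff v γ * F γ := by
    intro γ hγ
    have : (∑ l, (γ l : ℝ)) = p + 1 := by
      rw [mem_degEq, mdeg] at hγ
      exact_mod_cast hγ
    rw [← this, Finset.sum_mul]
    exact Finset.sum_congr rfl fun l _ => (mul_assoc _ _ _).symm
  rw [Finset.mul_sum, Finset.sum_congr rfl h1, Finset.sum_comm]
  simp only [Finset.mul_sum]
  rw [Finset.sum_comm]
  refine Finset.sum_congr rfl fun l _ => ?_
  have hsub : (degEq d p).map (addRightEmbedding (Pi.single l 1)) ⊆ degEq d (p + 1) := by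
    intro γ hγ
    obtain ⟨γ', hγ', rfl⟩ := Finset.mem_map.1 hγ
    rw [mem_degEq] at hγ' ⊢
    rw [addRightEmbedding_apply, mdeg_add_single, hγ']
  rw [← Finset.sum_subset hsub, Finset.sum_map]
  · refine Finset.sum_congr rfl fun γ _ => ?_
    rw [addRightEmbedding_apply, taylorCoeff_add_single]
    ring
  · intro γ hγ hn
    have : γ l = 0 := by
      by_contra h0
      apply hn
      have hle : Pi.single l 1 ≤ γ := by
        intro i
        by_cases hi : i = l
        · subst hi; simpa using Nat.one_le_iff_ne_zero.2 h0
        · simp [hi]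
      refine Finset.mem_map.2 ⟨γ - Pi.single l 1, ?_, ?_⟩
      · rw [mem_degEq] at hγ ⊢
        have := mdeg_add_single (γ - Pi.single l 1) l
        rw [tsub_add_cancel_of_le hle, hγ] at this
        omega
      · rw [addRightEmbedding_apply, tsub_add_cancel_of_le hle]
    simp [this]

/-- Differentiation along a ray of the degree-`p` part of the Taylor expansion of a jet. -/
theorem hasDerivAt_sum_taylorCoeff {Ω : Set (Fin d → ℝ)} (hΩ : IsOpen Ω) {m : ℕ}
    {F : (Fin d → ℕ) → (Fin d → ℝ) → ℝ}
    (hF : ∀ γ l, mdeg γ + 1 ≤ m → ∀ x ∈ Ω,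
      HasLineDerivAt ℝ (F γ) (F (γ + Pi.single l 1) x) x (Pi.single l 1))
    (hc : ∀ γ, mdeg γ ≤ m → ContinuousOn (F γ) Ω) {p : ℕ} (hp : p + 1 ≤ m) (v : Fin d → ℝ) {a : ℝ}
    (ha : a • v ∈ Ω) :
    HasDerivAt (fun a : ℝ => ∑ γ ∈ degEq d p, taylorCoeff v γ * F γ (a • v))
      ((p + 1) * ∑ γ ∈ degEq d (p + 1), taylorCoeff v γ * F γ (a • v)) a := by
  rw [← sum_taylorCoeff_succ v p fun γ => F γ (a • v)]
  refine HasDerivAt.fun_sum fun γ hγ => HasDerivAt.const_mul _ ?_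
  rw [mem_degEq] at hγ
  have h1 := hasFDerivAt_of_continuousOn_partial hΩ (f' := fun l => F (γ + Pi.single l 1))
    (fun l x hx => hF γ l (by omega) x hx)
    (fun l => hc _ (by rw [mdeg_add_single]; omega)) ha
  have h2 : HasDerivAt (fun a : ℝ => a • v) v a := by
    simpa using (hasDerivAt_id a).smul_const v
  have h3 := h1.comp_hasDerivAt a h2
  exact h3.congr_deriv (by simp [sum_apply])

/-- Taylor's formula for a function vanishing to order `s` at `0`, in terms of its normalized
derivatives. -/
theorem abs_sub_mul_pow_le {ρ : ℝ} (s : ℕ) :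
    ∀ (f : ℕ → ℝ → ℝ) (c δ : ℝ),
      (∀ p < s, ∀ a, |a| < ρ → HasDerivAt (f p) ((p + 1) * f (p + 1) a) a) →
      (∀ p < s, f p 0 = 0) → (∀ a, |a| < ρ → |f s a - c| ≤ δ) →
      ∀ a, |a| < ρ → |f 0 a - c * a ^ s| ≤ s.factorial * δ * |a| ^ s := by
  induction s with
  | zero =>
    intro f c δ _ _ hb a ha
    simpa using hb a ha
  | succ s ih =>
    intro f c δ hf h0 hb a ha
    -- If `f p` is the `p`-th derivative of `f 0` divided by `p!`, then `(p + 1) f (p + 1)` plays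
    -- the same role for the derivative of `f 0`. The factor `s + 1` in `c` and `δ` comes from this
    -- renormalization.
    have hIH := ih (fun p a => (p + 1) * f (p + 1) a) ((s + 1) * c) ((s + 1) * δ)
      (fun p hp a ha => by
        simpa using (hf (p + 1) (by omega) a ha).const_mul ((p : ℝ) + 1))
      (fun p hp => by simp [h0 (p + 1) (by omega)])
      (fun a ha => by
        rw [← mul_sub, abs_mul, abs_of_pos (by positivity : (0 : ℝ) < s + 1)]
        exact mul_le_mul_of_nonneg_left (hb a ha) (by positivity))
    have hδ : 0 ≤ δ := (abs_nonneg _).trans (hb a ha)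
    have hder : ∀ r ∈ Set.uIcc 0 a, HasDerivWithinAt (fun r => f 0 r - c * r ^ (s + 1))
        (f 1 r - (s + 1) * c * r ^ s) (Set.uIcc 0 a) r := by
      intro r hr
      have hra : |r| ≤ |a| := by simpa using Set.abs_sub_left_of_mem_uIcc hr
      have h1 := hf 0 (by omega) r (hra.trans_lt ha)
      have h2 := (hasDerivAt_pow (s + 1) r).const_mul c
      have h3 := (h1.sub h2).hasDerivWithinAt (s := Set.uIcc 0 a)
      refine h3.congr_deriv ?_
      simp
      ring
    have hbd : ∀ r ∈ Set.uIcc 0 a, ‖f 1 r - (s + 1) * c * r ^ s‖ ≤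
        s.factorial * ((s + 1) * δ) * |a| ^ s := by
      intro r hr
      have hra : |r| ≤ |a| := by simpa using Set.abs_sub_left_of_mem_uIcc hr
      have h1 := hIH r (hra.trans_lt ha)
      simp only [CharP.cast_eq_zero, zero_add, one_mul] at h1
      refine h1.trans ?_
      gcongr
    have hmv := Convex.norm_image_sub_le_of_norm_hasDerivWithin_le hder hbd (convex_uIcc 0 a)
      Set.left_mem_uIcc Set.right_mem_uIcc
    rw [h0 0 (by omega)] at hmv
    simp only [ne_eq, Nat.add_eq_zero_iff, one_ne_zero, and_false, not_false_eq_true, zero_pow,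
      mul_zero, sub_zero, Real.norm_eq_abs] at hmv
    refine hmv.trans (le_of_eq ?_)
    rw [Nat.factorial_succ]
    push_cast
    ring

end Taylor

/-! ### Leading term of the kernel form on vectors with vanishing moments. -/

section KernelTaylor

variable {d n : ℕ}

theorem kernelDeriv_zero (K : (Fin d → ℝ) → (Fin d → ℝ) → ℝ) : kernelDeriv K 0 0 = K := by
  have h : ∀ (L : List (Fin d)) (K : (Fin d → ℝ) → (Fin d → ℝ) → ℝ),
      L.foldr (fun _ G => G) K = K := by
    intro L K
    induction L with
    | nil => rfl
    | cons a L ih => simp [ih]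
  simp [kernelDeriv, h]

/-- The functional `∑ i, u_i f(x_i)` applied to the monomial `x^α`. -/
def moment (x : Fin n → Fin d → ℝ) (u : Fin n → ℝ) (α : Fin d → ℕ) : ℝ :=
  ∑ i, u i * ∏ l, x i l ^ α l

theorem sum_mul_taylorCoeff (x : Fin n → Fin d → ℝ) (u : Fin n → ℝ) (α : Fin d → ℕ) :
    ∑ i, u i * taylorCoeff (x i) α = moment x u α / mfact α := by
  simp only [taylorCoeff, moment, mul_div_assoc', Finset.sum_div]

/-- The degree `(p, q)` part of the Taylor expansion of `∑ u_i v_j K(a x_i, b x_j)`. -/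
noncomputable def jetForm (K : (Fin d → ℝ) → (Fin d → ℝ) → ℝ) (x : Fin n → Fin d → ℝ)
    (u v : Fin n → ℝ) (p q : ℕ) (a b : ℝ) : ℝ :=
  ∑ i, ∑ j, u i * v j * ∑ γ ∈ degEq d p, taylorCoeff (x i) γ *
    ∑ δ ∈ degEq d q, taylorCoeff (x j) δ * kernelDeriv K γ δ (a • x i) (b • x j)

theorem degEq_zero : degEq d 0 = {0} := by
  simp [degEq]

theorem taylorCoeff_zero (v : Fin d → ℝ) : taylorCoeff v 0 = 1 := by
  simp [taylorCoeff, mfact]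

theorem jetForm_zero_zero (K : (Fin d → ℝ) → (Fin d → ℝ) → ℝ) (x : Fin n → Fin d → ℝ)
    (u v : Fin n → ℝ) (a b : ℝ) :
    jetForm K x u v 0 0 a b = ∑ i, ∑ j, u i * v j * K (a • x i) (b • x j) := by
  simp [jetForm, degEq_zero, taylorCoeff_zero, kernelDeriv_zero]

/-- At `a = 0` the kernel derivatives no longer depend on `i`, so the sum over `i` collapses to
moments of `u` of degree `p`. -/
theorem jetForm_zero_left (K : (Fin d → ℝ) → (Fin d → ℝ) → ℝ) (x : Fin n → Fin d → ℝ)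
    {u : Fin n → ℝ} (v : Fin n → ℝ) {p : ℕ} (q : ℕ) (b : ℝ)
    (hu : ∀ α, mdeg α = p → moment x u α = 0) : jetForm K x u v p q 0 b = 0 := by
  have h : jetForm K x u v p q 0 b = ∑ γ ∈ degEq d p, (∑ i, u i * taylorCoeff (x i) γ) *
      ∑ j, v j * ∑ δ ∈ degEq d q, taylorCoeff (x j) δ * kernelDeriv K γ δ 0 (b • x j) := by
    simp only [jetForm, zero_smul, Finset.sum_mul_sum]
    rw [Finset.sum_comm' (t' := Finset.univ) (s' := fun _ => degEq d p) (by simp)]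
    refine Finset.sum_congr rfl fun i _ => ?_
    rw [Finset.sum_comm' (t' := Finset.univ) (s' := fun _ => degEq d p) (by simp)]
    refine Finset.sum_congr rfl fun j _ => ?_
    rw [Finset.mul_sum]
    exact Finset.sum_congr rfl fun γ _ => by ring
  rw [h]
  refine Finset.sum_eq_zero fun γ hγ => ?_
  rw [sum_mul_taylorCoeff, hu γ (mem_degEq.1 hγ), zero_div, zero_mul]

theorem jetForm_eq_sum (K : (Fin d → ℝ) → (Fin d → ℝ) → ℝ) (x : Fin n → Fin d → ℝ)
    (u v : Fin n → ℝ) (p q : ℕ) (a b : ℝ) :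
    jetForm K x u v p q a b = ∑ i, ∑ j, ∑ γ ∈ degEq d p, ∑ δ ∈ degEq d q,
      u i * v j * taylorCoeff (x i) γ * taylorCoeff (x j) δ *
        kernelDeriv K γ δ (a • x i) (b • x j) := by
  simp only [jetForm, Finset.mul_sum]
  refine Finset.sum_congr rfl fun i _ => Finset.sum_congr rfl fun j _ =>
    Finset.sum_congr rfl fun γ _ => Finset.sum_congr rfl fun δ _ => by ring

theorem jetForm_zero_right (K : (Fin d → ℝ) → (Fin d → ℝ) → ℝ) (x : Fin n → Fin d → ℝ)
    (u : Fin n → ℝ) {v : Fin n → ℝ} (p : ℕ) {q : ℕ} (a : ℝ)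
    (hv : ∀ α, mdeg α = q → moment x v α = 0) : jetForm K x u v p q a 0 = 0 := by
  simp only [jetForm_eq_sum, zero_smul]
  refine Finset.sum_eq_zero fun i _ => ?_
  rw [Finset.sum_comm]
  refine Finset.sum_eq_zero fun γ _ => ?_
  rw [Finset.sum_comm]
  refine Finset.sum_eq_zero fun δ hδ => ?_
  have : ∑ j, u i * v j * taylorCoeff (x i) γ * taylorCoeff (x j) δ *
      kernelDeriv K γ δ (a • x i) 0 =
      u i * taylorCoeff (x i) γ * kernelDeriv K γ δ (a • x i) 0 *
        ∑ j, v j * taylorCoeff (x j) δ := by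
    rw [Finset.mul_sum]
    exact Finset.sum_congr rfl fun j _ => by ring
  rw [this, sum_mul_taylorCoeff, hv δ (mem_degEq.1 hδ), zero_div, mul_zero]

theorem jetForm_at_zero (K : (Fin d → ℝ) → (Fin d → ℝ) → ℝ) (x : Fin n → Fin d → ℝ)
    (u v : Fin n → ℝ) (p q : ℕ) :
    jetForm K x u v p q 0 0 = ∑ γ ∈ degEq d p, ∑ δ ∈ degEq d q, moment x u γ *
      (kernelDeriv K γ δ 0 0 / ((mfact γ : ℝ) * mfact δ)) * moment x v δ := by
  simp only [jetForm_eq_sum, zero_smul]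
  have h : ∀ γ δ, moment x u γ * (kernelDeriv K γ δ 0 0 / ((mfact γ : ℝ) * mfact δ)) *
      moment x v δ = ∑ i, ∑ j, u i * v j * taylorCoeff (x i) γ * taylorCoeff (x j) δ *
        kernelDeriv K γ δ 0 0 := by
    intro γ δ
    have : moment x u γ * (kernelDeriv K γ δ 0 0 / ((mfact γ : ℝ) * mfact δ)) *
      moment x v δ = (moment x u γ / mfact γ) * (moment x v δ / mfact δ) *
        kernelDeriv K γ δ 0 0 := by ring
    rw [this, ← sum_mul_taylorCoeff, ← sum_mul_taylorCoeff, Finset.sum_mul_sum, Finset.sum_mul]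
    refine Finset.sum_congr rfl fun i _ => ?_
    rw [Finset.sum_mul]
    exact Finset.sum_congr rfl fun j _ => by ring
  simp only [h]
  have e : ∀ f : Fin n → Fin n → (Fin d → ℕ) → (Fin d → ℕ) → ℝ,
      ∑ i, ∑ j, ∑ γ ∈ degEq d p, ∑ δ ∈ degEq d q, f i j γ δ =
      ∑ γ ∈ degEq d p, ∑ δ ∈ degEq d q, ∑ i, ∑ j, f i j γ δ := by
    intro f
    calc _ = ∑ i, ∑ γ ∈ degEq d p, ∑ j, ∑ δ ∈ degEq d q, f i j γ δ :=
          Finset.sum_congr rfl fun i _ => Finset.sum_comm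
      _ = ∑ γ ∈ degEq d p, ∑ i, ∑ j, ∑ δ ∈ degEq d q, f i j γ δ := Finset.sum_comm
      _ = ∑ γ ∈ degEq d p, ∑ i, ∑ δ ∈ degEq d q, ∑ j, f i j γ δ :=
          Finset.sum_congr rfl fun γ _ => Finset.sum_congr rfl fun i _ => Finset.sum_comm
      _ = _ := Finset.sum_congr rfl fun γ _ => Finset.sum_comm
  exact e _

theorem eventually_smul_mem {Ω : Set (Fin d → ℝ)} (hΩ : IsOpen Ω) (h0 : (0 : Fin d → ℝ) ∈ Ω)
    (x : Fin n → Fin d → ℝ) : ∀ᶠ a : ℝ in 𝓝 0, ∀ i, a • x i ∈ Ω := by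
  refine eventually_all.2 fun i => ?_
  have : ContinuousAt (fun a : ℝ => a • x i) 0 := by fun_prop
  exact this.eventually_mem (by simpa using hΩ.mem_nhds h0)

/-- The degree in the second argument is `0` because expansion in `b` is completed before
differentiation in `a` is needed. -/
theorem jetForm_hasDerivAt_left {Ω : Set (Fin d → ℝ)} (hΩ : IsOpen Ω)
    {K : (Fin d → ℝ) → (Fin d → ℝ) → ℝ} {m : ℕ} (hK : IsCmm m Ω K) (x : Fin n → Fin d → ℝ)
    (u v : Fin n → ℝ) {p : ℕ} (hp : p + 1 ≤ m) {a b : ℝ} (ha : ∀ i, a • x i ∈ Ω)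
    (hb : ∀ i, b • x i ∈ Ω) :
    HasDerivAt (fun a => jetForm K x u v p 0 a b) ((p + 1) * jetForm K x u v (p + 1) 0 a b) a := by
  have h : ∀ (p : ℕ) (a : ℝ), jetForm K x u v p 0 a b =
      ∑ i, ∑ j, u i * v j * ∑ γ ∈ degEq d p, taylorCoeff (x i) γ *
        kernelDeriv K γ 0 (a • x i) (b • x j) := by
    intro p a
    simp [jetForm, degEq_zero, taylorCoeff_zero]
  simp only [h, Finset.mul_sum (a := (p + 1 : ℝ))]
  refine HasDerivAt.fun_sum fun i _ => HasDerivAt.fun_sum fun j _ => ?_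
  have := (hasDerivAt_sum_taylorCoeff hΩ (m := m) (F := fun γ y => kernelDeriv K γ 0 y (b • x j))
    (fun γ l hγ y hy => hK.hasDerivX γ 0 l hγ (by simp [mdeg]) y hy _ (hb j))
    (fun γ hγ => (hK.continuousOn γ 0 hγ (by simp [mdeg])).comp (f := fun y => (y, b • x j))
      (by fun_prop) fun y hy => ⟨hy, hb j⟩) hp (x i) (ha i)).const_mul (u i * v j)
  exact this.congr_deriv (by ring)

theorem jetForm_hasDerivAt_right {Ω : Set (Fin d → ℝ)} (hΩ : IsOpen Ω)
    {K : (Fin d → ℝ) → (Fin d → ℝ) → ℝ} {m : ℕ} (hK : IsCmm m Ω K) (x : Fin n → Fin d → ℝ)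
    (u v : Fin n → ℝ) {p q : ℕ} (hp : p ≤ m) (hq : q + 1 ≤ m) {a b : ℝ}
    (ha : ∀ i, a • x i ∈ Ω) (hb : ∀ i, b • x i ∈ Ω) :
    HasDerivAt (fun b => jetForm K x u v p q a b) ((q + 1) * jetForm K x u v p (q + 1) a b) b := by
  simp only [jetForm, Finset.mul_sum (a := (q + 1 : ℝ))]
  refine HasDerivAt.fun_sum fun i _ => HasDerivAt.fun_sum fun j _ => ?_
  have : HasDerivAt (fun b => ∑ γ ∈ degEq d p, taylorCoeff (x i) γ *
      ∑ δ ∈ degEq d q, taylorCoeff (x j) δ * kernelDeriv K γ δ (a • x i) (b • x j))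
      (∑ γ ∈ degEq d p, taylorCoeff (x i) γ * ((q + 1) *
      ∑ δ ∈ degEq d (q + 1), taylorCoeff (x j) δ * kernelDeriv K γ δ (a • x i) (b • x j))) b := by
    refine HasDerivAt.fun_sum fun γ hγ => HasDerivAt.const_mul _ ?_
    have hγ' : mdeg γ ≤ m := (mem_degEq.1 hγ).le.trans hp
    exact hasDerivAt_sum_taylorCoeff hΩ (m := m) (F := fun δ y => kernelDeriv K γ δ (a • x i) y)
      (fun δ l hδ y hy => hK.hasDerivY γ δ l hγ' hδ _ (ha i) y hy)
      (fun δ hδ => (hK.continuousOn γ δ hγ' hδ).comp (f := fun y => (a • x i, y))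
      (by fun_prop) fun y hy => ⟨ha i, hy⟩) hq (x j) (hb j)
  refine (this.const_mul (u i * v j)).congr_deriv ?_
  rw [mul_left_comm, Finset.mul_sum (a := (q + 1 : ℝ))]
  congr 1
  exact Finset.sum_congr rfl fun γ _ => by ring

theorem jetForm_continuousAt {Ω : Set (Fin d → ℝ)} (hΩ : IsOpen Ω) (h0 : (0 : Fin d → ℝ) ∈ Ω)
    {K : (Fin d → ℝ) → (Fin d → ℝ) → ℝ} {m : ℕ} (hK : IsCmm m Ω K) (x : Fin n → Fin d → ℝ)
    (u v : Fin n → ℝ) {p q : ℕ} (hp : p ≤ m) (hq : q ≤ m) :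
    ContinuousAt (fun z : ℝ × ℝ => jetForm K x u v p q z.1 z.2) (0, 0) := by
  simp only [jetForm]
  refine tendsto_finsetSum _ fun i _ => tendsto_finsetSum _ fun j _ => Tendsto.const_mul _ <|
    tendsto_finsetSum _ fun γ hγ => Tendsto.const_mul _ <|
    tendsto_finsetSum _ fun δ hδ => Tendsto.const_mul _ ?_
  have h1 := hK.continuousOn γ δ ((mem_degEq.1 hγ).le.trans hp) ((mem_degEq.1 hδ).le.trans hq)
  have h2 : ContinuousAt (fun z : ℝ × ℝ => (z.1 • x i, z.2 • x j)) (0, 0) := by fun_prop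
  have h3 : ContinuousAt (fun z : (Fin d → ℝ) × (Fin d → ℝ) => kernelDeriv K γ δ z.1 z.2)
      ((0 : ℝ) • x i, (0 : ℝ) • x j) := by
    refine h1.continuousAt ((hΩ.prod hΩ).mem_nhds ?_)
    simpa using h0
  exact ContinuousAt.comp (f := fun z : ℝ × ℝ => (z.1 • x i, z.2 • x j)) h3 h2

/-- The leading term of the quadratic form of the kernel matrix on vectors annihilating polynomials
of degree `< s` and `< t`. -/
theorem tendsto_kernelMatrix_form {Ω : Set (Fin d → ℝ)} (hΩ : IsOpen Ω)
    (h0 : (0 : Fin d → ℝ) ∈ Ω) {K : (Fin d → ℝ) → (Fin d → ℝ) → ℝ} {m : ℕ} (hK : IsCmm m Ω K)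
    (x : Fin n → Fin d → ℝ) {u v : Fin n → ℝ} {s t : ℕ} (hs : s ≤ m) (ht : t ≤ m)
    (hu : ∀ α, mdeg α < s → moment x u α = 0) (hv : ∀ α, mdeg α < t → moment x v α = 0) :
    Tendsto (fun ε => (∑ i, ∑ j, u i * v j * kernelMatrix K x ε i j) / ε ^ (s + t)) (𝓝[≠] 0)
      (𝓝 (∑ γ ∈ degEq d s, ∑ δ ∈ degEq d t, moment x u γ *
        (kernelDeriv K γ δ 0 0 / ((mfact γ : ℝ) * mfact δ)) * moment x v δ)) := by
  rw [← jetForm_at_zero]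
  set c := jetForm K x u v s t 0 0 with hc
  rw [Metric.tendsto_nhds]
  intro η hη
  obtain ⟨θ, hθ0, hθ⟩ : ∃ θ : ℝ, 0 < θ ∧ s.factorial * (t.factorial * θ) < η :=
    ⟨η / (2 * (s.factorial * t.factorial)), by positivity, by field_simp; norm_num⟩
  have hcont := (jetForm_continuousAt hΩ h0 hK x u v hs ht).tendsto
  have hev1 := hcont (Metric.closedBall_mem_nhds _ hθ0)
  have hev2 : ∀ᶠ z : ℝ × ℝ in 𝓝 (0, 0), (∀ i, z.1 • x i ∈ Ω) ∧ ∀ i, z.2 • x i ∈ Ω := by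
    rw [nhds_prod_eq]
    exact (eventually_smul_mem hΩ h0 x).prod_mk (eventually_smul_mem hΩ h0 x)
  obtain ⟨ρ, hρ0, hρ⟩ := Metric.eventually_nhds_iff_ball.1 (Filter.Eventually.and hev1 hev2)
  have hmem : ∀ a b : ℝ, |a| < ρ → |b| < ρ → |jetForm K x u v s t a b - c| ≤ θ ∧
      (∀ i, a • x i ∈ Ω) ∧ ∀ i, b • x i ∈ Ω := by
    intro a b ha hb
    have := hρ (a, b) (by simp [Prod.dist_eq, ha, hb])
    simpa [Real.dist_eq] using this
  -- The parameters `a` and `b` stay independent until the end. The degree-`s` jet in `a` is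
  -- expanded in `b`, and the resulting estimate is the remainder hypothesis for the expansion in
  -- `a`. In this way only derivatives of order at most `m` in each argument occur, not a joint
  -- expansion of order `s + t`.
  have step1 : ∀ a b, |a| < ρ → |b| < ρ →
      |jetForm K x u v s 0 a b - c * b ^ t| ≤ t.factorial * θ * |b| ^ t := fun a b ha hb =>
    abs_sub_mul_pow_le t (fun q b => jetForm K x u v s q a b) c θ
      (fun q hq b hb => jetForm_hasDerivAt_right hΩ hK x u v hs (by omega) (hmem a b ha hb).2.1
        (hmem a b ha hb).2.2)
      (fun q hq => jetForm_zero_right K x u s a fun α hα => hv α (by omega))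
      (fun b hb => (hmem a b ha hb).1) b hb
  have step2 : ∀ a b, |a| < ρ → |b| < ρ → |jetForm K x u v 0 0 a b - c * b ^ t * a ^ s| ≤
      s.factorial * (t.factorial * θ * |b| ^ t) * |a| ^ s := fun a b ha hb =>
    abs_sub_mul_pow_le s (fun p a => jetForm K x u v p 0 a b) (c * b ^ t) _
      (fun p hp a ha => jetForm_hasDerivAt_left hΩ hK x u v (by omega) (hmem a b ha hb).2.1
        (hmem a b ha hb).2.2)
      (fun p hp => jetForm_zero_left K x v 0 b fun α hα => hu α (by omega))
      (fun a ha => step1 a b ha hb) a ha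
  filter_upwards [nhdsWithin_le_nhds (Metric.ball_mem_nhds (0 : ℝ) hρ0), self_mem_nhdsWithin]
    with ε hε hε0
  have hε' : |ε| < ρ := by simpa using hε
  have hε0' : ε ≠ 0 := hε0
  have h2 := step2 ε ε hε' hε'
  rw [jetForm_zero_zero] at h2
  change |(∑ i, ∑ j, u i * v j * kernelMatrix K x ε i j) - c * ε ^ t * ε ^ s| ≤ _ at h2
  rw [Real.dist_eq]
  have hpos : 0 < |ε| ^ (s + t) := by positivity
  have h3 : (∑ i, ∑ j, u i * v j * kernelMatrix K x ε i j) / ε ^ (s + t) - c =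
      ((∑ i, ∑ j, u i * v j * kernelMatrix K x ε i j) - c * ε ^ t * ε ^ s) / ε ^ (s + t) := by
    field_simp
    ring
  rw [h3, abs_div, abs_pow, div_lt_iff₀ hpos]
  refine h2.trans_lt ?_
  calc s.factorial * (t.factorial * θ * |ε| ^ t) * |ε| ^ s
      = s.factorial * (t.factorial * θ) * |ε| ^ (s + t) := by ring
    _ < _ := by gcongr

end KernelTaylor

/-! ### Main terms of the eigenvalues from rescaled determinants. -/

section DetLimit

open Matrix

variable {ι : Type*} [Fintype ι] [DecidableEq ι]

/-- The limit of `det (A(ε) - ε^{2s} t)` after graded rescaling of rows and columns. -/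
theorem det_limit_eq_prod {deg : ι → ℕ} {A : ℝ → Matrix ι ι ℝ} {lam : ι → ℝ → ℝ} {μ : ι → ℝ}
    {C : Matrix ι ι ℝ}
    (hA : ∀ i j, Tendsto (fun ε => A ε i j / ε ^ (deg i + deg j)) (𝓝[≠] 0) (𝓝 (C i j)))
    (hlam : ∀ j, Tendsto (fun ε => lam j ε / ε ^ (2 * deg j)) (𝓝[≠] 0) (𝓝 (μ j)))
    (hdet : ∀ᶠ ε in 𝓝[≠] 0, ∀ x : ℝ, (A ε - x • (1 : Matrix ι ι ℝ)).det = ∏ j, (lam j ε - x))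
    (s : ℕ) (t : ℝ) :
    (Matrix.of fun i j => C i j * 0 ^ ((deg i - s) + (deg j - s)) -
      if i = j then t * 0 ^ (2 * (s - deg i)) else 0).det =
    ∏ j, (μ j * 0 ^ (2 * (deg j - s)) - t * 0 ^ (2 * (s - deg j))) := by
  have hpow : ∀ k : ℕ, Tendsto (fun ε : ℝ => ε ^ k) (𝓝[≠] 0) (𝓝 (0 ^ k)) := fun k =>
    ((continuous_pow k).tendsto 0).mono_left nhdsWithin_le_nhds
  let B : ℝ → Matrix ι ι ℝ := fun ε => Matrix.of fun i j =>
    A ε i j / ε ^ (deg i + deg j) * ε ^ ((deg i - s) + (deg j - s)) -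
      if i = j then t * ε ^ (2 * (s - deg i)) else 0
  have hB : Tendsto (fun ε => (B ε).det) (𝓝[≠] 0) (𝓝 (Matrix.of fun i j =>
      C i j * 0 ^ ((deg i - s) + (deg j - s)) -
      if i = j then t * 0 ^ (2 * (s - deg i)) else 0).det) := by
    refine ((continuous_id.matrix_det (A := fun M : Matrix ι ι ℝ => M)).tendsto _).comp ?_
    refine tendsto_pi_nhds.2 fun i => tendsto_pi_nhds.2 fun j => ?_
    refine ((hA i j).mul (hpow _)).sub ?_
    split_ifs
    · exact (hpow _).const_mul t
    · exact tendsto_const_nhds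
  have hL : Tendsto (fun ε => ∏ j, (lam j ε / ε ^ (2 * deg j) * ε ^ (2 * (deg j - s)) -
      t * ε ^ (2 * (s - deg j)))) (𝓝[≠] 0)
      (𝓝 (∏ j, (μ j * 0 ^ (2 * (deg j - s)) - t * 0 ^ (2 * (s - deg j))))) :=
    tendsto_finsetProd _ fun j _ => ((hlam j).mul (hpow _)).sub ((hpow _).const_mul t)
  refine tendsto_nhds_unique (hB.congr' ?_) hL
  filter_upwards [hdet, self_mem_nhdsWithin] with ε h1 h2
  have hε : ε ≠ 0 := h2
  -- The scaling stops at degree `s`. What remains are the truncated powers `ε ^ (deg i - s)` and `ε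
  -- ^ (2 * (s - deg i))`; in the limit the first remove the entries of `C` above degree `s`, the
  -- second remove `t` below degree `s`.
  let D : ι → ℝ := fun i => ε ^ min (deg i) s
  have hD : ∀ i, D i ≠ 0 := fun i => pow_ne_zero _ hε
  have hBA : A ε - (ε ^ (2 * s) * t) • (1 : Matrix ι ι ℝ) = diagonal D * B ε * diagonal D := by
    ext i j
    rw [mul_diagonal, diagonal_mul]
    simp only [B, D, Matrix.of_apply, Matrix.sub_apply, Matrix.smul_apply, one_apply, smul_eq_mul]
    have e1 : ε ^ min (deg i) s * (A ε i j / ε ^ (deg i + deg j) *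
        ε ^ ((deg i - s) + (deg j - s))) * ε ^ min (deg j) s = A ε i j := by
      have : ε ^ min (deg i) s * ε ^ ((deg i - s) + (deg j - s)) * ε ^ min (deg j) s =
          ε ^ (deg i + deg j) := by
        rw [← pow_add, ← pow_add]
        congr 1
        omega
      have h3 : ε ^ (deg i + deg j) ≠ 0 := pow_ne_zero _ hε
      rw [← this] at h3 ⊢
      field_simp
    rw [mul_sub, sub_mul, e1]
    congr 1
    split_ifs with hij
    · subst hij
      have : ε ^ (2 * s) = ε ^ min (deg i) s * ε ^ (2 * (s - deg i)) * ε ^ min (deg i) s := by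
        rw [← pow_add, ← pow_add]
        congr 1
        omega
      rw [this]
      ring
    · simp
  have h3 := h1 (ε ^ (2 * s) * t)
  rw [hBA, det_mul, det_mul, det_diagonal] at h3
  have h4 : ∏ j, (lam j ε - ε ^ (2 * s) * t) = (∏ j, D j) * (∏ j,
      (lam j ε / ε ^ (2 * deg j) * ε ^ (2 * (deg j - s)) - t * ε ^ (2 * (s - deg j)))) *
      ∏ j, D j := by
    rw [← Finset.prod_mul_distrib, ← Finset.prod_mul_distrib]
    refine Finset.prod_congr rfl fun j _ => ?_
    simp only [D]
    have e1 : ε ^ (2 * deg j) = ε ^ min (deg j) s * ε ^ (2 * (deg j - s)) * ε ^ min (deg j) s := by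
      rw [← pow_add, ← pow_add]
      congr 1
      omega
    have e2 : ε ^ (2 * s) = ε ^ min (deg j) s * ε ^ (2 * (s - deg j)) * ε ^ min (deg j) s := by
      rw [← pow_add, ← pow_add]
      congr 1
      omega
    rw [e1, e2]
    field_simp
  rw [h4] at h3
  have hP : ∏ j, D j ≠ 0 := Finset.prod_ne_zero_iff.2 fun j _ => hD j
  exact mul_left_cancel₀ hP (mul_right_cancel₀ hP h3)

/-- Splitting an index type according to a degree being below, at, or above `s`. -/
noncomputable def degSplit (deg : ι → ℕ) (s : ℕ) :
    ({j // deg j < s} ⊕ {j // deg j = s}) ⊕ {j // s < deg j} ≃ ι :=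
  Equiv.ofBijective (Sum.elim (Sum.elim Subtype.val Subtype.val) Subtype.val) <| by
    constructor
    · rintro ((⟨i, hi⟩ | ⟨i, hi⟩) | ⟨i, hi⟩) ((⟨j, hj⟩ | ⟨j, hj⟩) | ⟨j, hj⟩) h <;>
        simp only [Sum.elim_inl, Sum.elim_inr] at h <;> subst h <;> first | rfl | omega
    · intro j
      rcases lt_trichotomy (deg j) s with h | h | h
      · exact ⟨.inl (.inl ⟨j, h⟩), rfl⟩
      · exact ⟨.inl (.inr ⟨j, h⟩), rfl⟩
      · exact ⟨.inr ⟨j, h⟩, rfl⟩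

omit [Fintype ι] in
@[simp]
theorem degSplit_inl_inl (deg : ι → ℕ) (s : ℕ) (j : {j // deg j < s}) :
    degSplit deg s (.inl (.inl j)) = j.1 := rfl

omit [Fintype ι] in
@[simp]
theorem degSplit_inl_inr (deg : ι → ℕ) (s : ℕ) (j : {j // deg j = s}) :
    degSplit deg s (.inl (.inr j)) = j.1 := rfl

omit [Fintype ι] in
@[simp]
theorem degSplit_inr (deg : ι → ℕ) (s : ℕ) (j : {j // s < deg j}) :
    degSplit deg s (.inr j) = j.1 := rfl

/-- The block of a matrix with rows selected by `p` and columns selected by `q`. -/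
abbrev Matrix.subBlock (C : Matrix ι ι ℝ) (p q : ι → Prop) : Matrix {j // p j} {j // q j} ℝ :=
  C.submatrix Subtype.val Subtype.val

/-- The Schur complement of the block of degree `< s` in the block of degree `≤ s`. -/
noncomputable def gradedSchur (deg : ι → ℕ) (C : Matrix ι ι ℝ) (s : ℕ) :
    Matrix {j // deg j = s} {j // deg j = s} ℝ :=
  C.subBlock (fun j => deg j = s) (fun j => deg j = s) -
    C.subBlock (fun j => deg j = s) (fun j => deg j < s) *
      (C.subBlock (fun j => deg j < s) (fun j => deg j < s))⁻¹ *
      C.subBlock (fun j => deg j < s) (fun j => deg j = s)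

/-- By truncated subtraction and `0 ^ 0 = 1`, the powers of `0` are indicators of `deg ≤ s` and `deg
≥ s`. The matrix is therefore block diagonal: `C_{≤s}` with `t` subtracted in degree `s` only, and
`-t` above. Cancelling the powers of `-t` and applying the Schur formula gives a polynomial identity
in `t`; its leading coefficients give the product and the rest the characteristic polynomial. -/
theorem graded_main_terms {deg : ι → ℕ} {μ : ι → ℝ} {C : Matrix ι ι ℝ} {s : ℕ}
    (h : ∀ t : ℝ, (Matrix.of fun i j => C i j * 0 ^ ((deg i - s) + (deg j - s)) -
      if i = j then t * 0 ^ (2 * (s - deg i)) else 0).det =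
      ∏ j, (μ j * 0 ^ (2 * (deg j - s)) - t * 0 ^ (2 * (s - deg j))))
    (hC : (C.subBlock (fun j => deg j < s) (fun j => deg j < s)).det ≠ 0) :
    ∏ j : {j // deg j < s}, μ j = (C.subBlock (fun j => deg j < s) (fun j => deg j < s)).det ∧
      (gradedSchur deg C s).charpoly = ∏ j : {j // deg j = s}, (X - Polynomial.C (μ j)) := by
  set Caa := C.subBlock (fun j => deg j < s) (fun j => deg j < s) with hCaa
  set S := gradedSchur deg C s with hS
  have key : ∀ t : ℝ, t ≠ 0 → Caa.det * (S - t • 1).det =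
      (∏ j : {j // deg j < s}, μ j) * ∏ j : {j // deg j = s}, (μ j - t) := by
    intro t ht
    have h1 := h t
    rw [← det_submatrix_equiv_self (degSplit deg s), ← (degSplit deg s).prod_comp,
      Fintype.prod_sum_type, Fintype.prod_sum_type] at h1
    have h2 : (Matrix.of fun i j => C i j * 0 ^ ((deg i - s) + (deg j - s)) -
        if i = j then t * 0 ^ (2 * (s - deg i)) else 0).submatrix (degSplit deg s)
          (degSplit deg s) =
        fromBlocks (fromBlocks Caa (C.subBlock (fun j => deg j < s) (fun j => deg j = s))
          (C.subBlock (fun j => deg j = s) (fun j => deg j < s))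
          (C.subBlock (fun j => deg j = s) (fun j => deg j = s) - t • 1)) 0 0
          (diagonal fun _ => -t) := by
      ext ((⟨i, hi⟩ | ⟨i, hi⟩) | ⟨i, hi⟩) ((⟨j, hj⟩ | ⟨j, hj⟩) | ⟨j, hj⟩)
      · have : s - deg i ≠ 0 := by omega
        simp [hCaa, hi.le, hj.le, this]
      · have : i ≠ j := by rintro rfl; omega
        simp [hi.le, hj.le, this]
      · have : i ≠ j := by rintro rfl; omega
        have h' : deg j - s ≠ 0 := by omega
        simp [this, h']
      · have : i ≠ j := by rintro rfl; omega
        simp [hi.le, hj.le, this]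
      · simp [hi.le, hj.le, hi.ge, one_apply]
      · have : i ≠ j := by rintro rfl; omega
        have h' : deg j - s ≠ 0 := by omega
        simp [this, h']
      · have : i ≠ j := by rintro rfl; omega
        have h' : deg i - s ≠ 0 := by omega
        simp [this, h']
      · have : i ≠ j := by rintro rfl; omega
        have h' : deg i - s ≠ 0 := by omega
        simp [this, h']
      · have h' : deg i - s ≠ 0 := by omega
        have h'' : s - deg i = 0 := by omega
        by_cases hij : i = j
        · subst hij
          simp [h', h'']
        · simp [h', hij]
    have : Invertible Caa := Caa.invertibleOfIsUnitDet (isUnit_iff_ne_zero.2 hC)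
    have h3 : C.subBlock (fun j => deg j = s) (fun j => deg j = s) - t • 1 -
        C.subBlock (fun j => deg j = s) (fun j => deg j < s) * ⅟Caa *
        C.subBlock (fun j => deg j < s) (fun j => deg j = s) = S - t • 1 := by
      rw [hS, gradedSchur, invOf_eq_nonsing_inv]
      abel
    rw [h2, det_fromBlocks_zero₂₁, det_fromBlocks₁₁, h3, det_diagonal] at h1
    have e1 : ∀ j : {j // deg j < s}, μ (degSplit deg s (.inl (.inl j))) *
        0 ^ (2 * (deg (degSplit deg s (.inl (.inl j))) - s)) -
        t * 0 ^ (2 * (s - deg (degSplit deg s (.inl (.inl j))))) = μ j := by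
      rintro ⟨j, hj⟩
      have : s - deg j ≠ 0 := by omega
      simp [hj.le, this]
    have e2 : ∀ j : {j // deg j = s}, μ (degSplit deg s (.inl (.inr j))) *
        0 ^ (2 * (deg (degSplit deg s (.inl (.inr j))) - s)) -
        t * 0 ^ (2 * (s - deg (degSplit deg s (.inl (.inr j))))) = μ j - t := by
      rintro ⟨j, hj⟩
      simp [hj]
    have e3 : ∀ j : {j // s < deg j}, μ (degSplit deg s (.inr j)) *
        0 ^ (2 * (deg (degSplit deg s (.inr j)) - s)) -
        t * 0 ^ (2 * (s - deg (degSplit deg s (.inr j)))) = -t := by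
      rintro ⟨j, hj⟩
      have : deg j - s ≠ 0 := by omega
      simp [hj.le, this]
    simp only [e1, e2, e3] at h1
    exact mul_right_cancel₀ (Finset.prod_ne_zero_iff.2 fun _ _ => neg_ne_zero.2 ht) h1
  have hpoly : Polynomial.C Caa.det * S.charpoly = Polynomial.C (∏ j : {j // deg j < s}, μ j) *
      ∏ j : {j // deg j = s}, (X - Polynomial.C (μ j)) := by
    refine Polynomial.eq_of_infinite_eval_eq _ _ ((Set.finite_singleton (0 : ℝ)).infinite_compl.mono
      fun t ht => ?_)
    have h1 := key t ht
    have h2 : S.charpoly.eval t = (-1) ^ Fintype.card {j // deg j = s} * (S - t • 1).det := by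
      rw [eval_charpoly, ← det_neg, neg_sub, smul_one_eq_diagonal]
      rfl
    have h3 : ∏ j : {j // deg j = s}, (t - μ j) =
        (-1) ^ Fintype.card {j // deg j = s} * ∏ j : {j // deg j = s}, (μ j - t) := by
      rw [← Finset.card_univ, ← Finset.prod_const, ← Finset.prod_mul_distrib]
      exact Finset.prod_congr rfl fun j _ => by ring
    simp only [Set.mem_ofPred_eq, eval_mul, eval_C, eval_prod, eval_sub, eval_X, h2, h3]
    linear_combination (-1) ^ Fintype.card {j // deg j = s} * h1
  have hm : (∏ j : {j // deg j = s}, (X - Polynomial.C (μ j))).Monic :=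
    monic_prod_of_monic _ _ fun j _ => monic_X_sub_C _
  have hlc := congrArg leadingCoeff hpoly
  rw [leadingCoeff_mul, leadingCoeff_mul, leadingCoeff_C, leadingCoeff_C,
    (charpoly_monic S).leadingCoeff, hm.leadingCoeff, mul_one, mul_one] at hlc
  refine ⟨hlc.symm, ?_⟩
  rw [← hlc] at hpoly
  exact mul_left_cancel₀ (C_ne_zero.2 hC) hpoly

end DetLimit

/-! ### From projectors to orthonormal eigenvectors and determinants. -/

section EVD

open Matrix

variable {n : ℕ}

theorem vecMulVec_mul_eq_zero {p q : Fin n → ℝ} (hp : p ⬝ᵥ p = 1) (hq : q ⬝ᵥ q = 1)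
    (h : vecMulVec p p * vecMulVec q q = 0) : p ⬝ᵥ q = 0 := by
  have h1 := congrArg (fun M : Matrix (Fin n) (Fin n) ℝ => p ⬝ᵥ (M *ᵥ q)) h
  simpa [vecMulVec_mul_vecMulVec, vecMulVec_mulVec, smul_mulVec, vecMulVec_smul, hp, hq] using h1

theorem dotProduct_self_of_vecMulVec {p : Fin n → ℝ}
    (hi : vecMulVec p p * vecMulVec p p = vecMulVec p p) (hr : (vecMulVec p p).rank = 1) :
    p ⬝ᵥ p = 1 := by
  have := trace_eq_rank_of_idempotent hi
  rw [hr, trace_vecMulVec] at this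
  exact_mod_cast this

/-- A family of pairwise orthogonal rank-one projectors comes from an orthonormal family. -/
theorem exists_orthogonal_of_projectors {P : Fin n → Matrix (Fin n) (Fin n) ℝ}
    (hs : ∀ j, (P j).IsSymm) (hi : ∀ j, P j * P j = P j) (hr : ∀ j, (P j).rank = 1)
    (ho : ∀ i j, i ≠ j → P i * P j = 0) :
    ∃ U : Matrix (Fin n) (Fin n) ℝ, Uᵀ * U = 1 ∧ ∀ j, P j = vecMulVec (U.col j) (U.col j) := by
  have h : ∀ j, ∃ p : Fin n → ℝ, p ⬝ᵥ p = 1 ∧ P j = vecMulVec p p := fun j =>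
    exists_eq_vecMulVec_of_trace_eq_one (hs j) (hi j) (by
      rw [trace_eq_rank_of_idempotent (hi j), hr j, Nat.cast_one])
  choose p hp hP using h
  refine ⟨(Matrix.of p)ᵀ, ?_, hP⟩
  ext i j
  rw [transpose_transpose, mul_apply]
  change p i ⬝ᵥ p j = _
  by_cases hij : i = j
  · subst hij; simp [hp]
  · rw [one_apply_ne hij]
    refine vecMulVec_mul_eq_zero (hp i) (hp j) ?_
    rw [← hP, ← hP, ho i j hij]

theorem sum_smul_vecMulVec_eq (U : Matrix (Fin n) (Fin n) ℝ) (c : Fin n → ℝ) :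
    ∑ j, c j • vecMulVec (U.col j) (U.col j) = U * diagonal c * Uᵀ := by
  ext a b
  rw [mul_apply, Matrix.sum_apply]
  refine Finset.sum_congr rfl fun j _ => ?_
  simp [vecMulVec_apply, mul_diagonal]
  ring

/-- The conjugation by `Q` is included because the entrywise limits are available only in that
basis. -/
theorem IsAnalyticEVD.eventually_det {A : ℝ → Matrix (Fin n) (Fin n) ℝ} {lam : Fin n → ℝ → ℝ}
    {P : Fin n → ℝ → Matrix (Fin n) (Fin n) ℝ} (h : IsAnalyticEVD A lam P)
    {Q : Matrix (Fin n) (Fin n) ℝ} (hQ : Qᵀ * Q = 1) :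
    ∀ᶠ ε in 𝓝 0, ∀ x : ℝ, (Qᵀ * A ε * Q - x • (1 : Matrix (Fin n) (Fin n) ℝ)).det =
      ∏ j, (lam j ε - x) := by
  filter_upwards [h.isSymm, h.isIdempotent, h.rank_eq_one, h.orthogonal, h.eq_sum]
    with ε h1 h2 h3 h4 h5 x
  obtain ⟨U, hU, hP⟩ := exists_orthogonal_of_projectors h1 h2 h3 h4
  simp only [hP, sum_smul_vecMulVec_eq] at h5
  have hU' : U * Uᵀ = 1 := mul_eq_one_comm.1 hU
  have e1 : Qᵀ * A ε * Q - x • (1 : Matrix (Fin n) (Fin n) ℝ) =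
      Qᵀ * (U * diagonal (fun j => lam j ε - x) * Uᵀ) * Q := by
    have : diagonal (fun j => lam j ε - x) = diagonal (fun j => lam j ε) -
        x • (1 : Matrix (Fin n) (Fin n) ℝ) := by
      rw [smul_one_eq_diagonal, diagonal_sub]
    rw [this, mul_sub, sub_mul, mul_sub, sub_mul, ← h5, Matrix.mul_smul, Matrix.smul_mul, mul_one,
      hU', Matrix.mul_smul, Matrix.smul_mul, mul_one, hQ]
  rw [e1, det_mul, det_mul, det_mul, det_mul, det_diagonal]
  have d1 : Qᵀ.det * Q.det = 1 := by rw [← det_mul, hQ, det_one]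
  have d2 : U.det * Uᵀ.det = 1 := by rw [← det_mul, hU', det_one]
  linear_combination (∏ j, (lam j ε - x)) * (U.det * Uᵀ.det * d1 + d2)

theorem HasMainTerms.tendsto {d : ℕ} {e : ℕ ≃ (Fin d → ℕ)} {lam : Fin n → ℝ → ℝ} {μ : Fin n → ℝ}
    (h : HasMainTerms e lam μ) (j : Fin n) :
    Tendsto (fun ε => lam j ε / ε ^ (2 * mdeg (e j))) (𝓝[≠] 0) (𝓝 (μ j)) := by
  obtain ⟨r, hr, hl⟩ := h j
  have hr0 : Tendsto r (𝓝[≠] 0) (𝓝 0) :=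
    (hr.trans_tendsto tendsto_id).mono_left nhdsWithin_le_nhds
  have := hr0.const_add (μ j)
  rw [add_zero] at this
  refine this.congr' ?_
  filter_upwards [hl.filter_mono nhdsWithin_le_nhds, self_mem_nhdsWithin] with ε h1 h2
  have : ε ^ (2 * mdeg (e j)) ≠ 0 := pow_ne_zero _ h2
  rw [h1, mul_div_cancel_left₀ _ this]

end EVD

theorem Fintype.sum_eq_sum_subtype_of_eq_zero {ι : Type*} [Fintype ι] {p : ι → Prop}
    [DecidablePred p] (f : ι → ℝ) (h : ∀ i, ¬ p i → f i = 0) : ∑ i, f i = ∑ i : {i // p i}, f i := by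
  rw [← Finset.sum_subtype (Finset.univ.filter p) (by simp) f, Finset.sum_filter_of_ne]
  intro i _ hi
  by_contra hp
  exact hi (h i hp)

/-! ### Graded positions, moments and the triangular factor. -/

section Graded

open Matrix

variable {d n k : ℕ} {e : ℕ ≃ (Fin d → ℕ)}

theorem IsGradedEnum.symm_lt (he : IsGradedEnum e) {α β : Fin d → ℕ} (h : mdeg α < mdeg β) :
    e.symm α < e.symm β :=
  he _ _ (by simpa using h)

/-- If `e j` had degree above `k`, all of `ℙ_k` would precede it, so `j ≥ #ℙ_k ≥ n`. -/
theorem IsGradedEnum.mdeg_le (he : IsGradedEnum e) (hn' : n ≤ (degLT d (k + 1)).card)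
    (j : Fin n) : mdeg (e j) ≤ k := by
  by_contra! h
  have h1 : (degLT d (k + 1)).image e.symm ⊆ Finset.range j := by
    intro i hi
    obtain ⟨α, hα, rfl⟩ := Finset.mem_image.1 hi
    rw [mem_degLT] at hα
    have := he.symm_lt (hα.trans_le h)
    simpa using this
  have h2 := Finset.card_le_card h1
  rw [Finset.card_image_of_injective _ e.symm.injective, Finset.card_range] at h2
  have := j.2
  omega

/-- Otherwise the first `n` multi-indices would all lie in `ℙ_{k-1}`, which has fewer than `n`
elements. -/
theorem IsGradedEnum.symm_lt_of_mdeg_lt (he : IsGradedEnum e) (hn : (degLT d k).card < n)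
    {α : Fin d → ℕ} (hα : mdeg α < k) : e.symm α < n := by
  by_contra! h
  have h1 : (Finset.range n).image e ⊆ degLT d k := by
    intro β hβ
    obtain ⟨i, hi, rfl⟩ := Finset.mem_image.1 hβ
    rw [mem_degLT]
    by_contra! hc
    have := he.symm_lt (hα.trans_le hc)
    simp at this hi
    omega
  have h2 := Finset.card_le_card h1
  rw [Finset.card_image_of_injective _ e.injective, Finset.card_range] at h2
  omega

/-- The positions of degree `< s` correspond to the multi-indices of degree `< s`. -/
def ltEquiv (he : IsGradedEnum e) (hn : (degLT d k).card < n) {s : ℕ} (hs : s ≤ k) :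
    {j : Fin n // mdeg (e j) < s} ≃ degLT d s where
  toFun j := ⟨e j.1, mem_degLT.2 j.2⟩
  invFun α := ⟨⟨e.symm α.1, he.symm_lt_of_mdeg_lt hn ((mem_degLT.1 α.2).trans_le hs)⟩, by
    simpa using mem_degLT.1 α.2⟩
  left_inv j := by ext; simp
  right_inv α := by ext; simp

/-- The positions of degree `s < k` correspond to the multi-indices of degree `s`. -/
def eqEquiv (he : IsGradedEnum e) (hn : (degLT d k).card < n) {s : ℕ} (hs : s < k) :
    {j : Fin n // mdeg (e j) = s} ≃ degEq d s where
  toFun j := ⟨e j.1, mem_degEq.2 j.2⟩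
  invFun α := ⟨⟨e.symm α.1, he.symm_lt_of_mdeg_lt hn ((mem_degEq.1 α.2).trans_lt hs)⟩, by
    simpa using mem_degEq.1 α.2⟩
  left_inv j := by ext; simp
  right_inv α := by ext; simp

variable {x : Fin n → Fin d → ℝ} {Q : Matrix (Fin n) (Fin n) ℝ}

theorem transpose_mul_vandermondeND_apply (A : Finset (Fin d → ℕ)) (j : Fin n) (α : A) :
    (Qᵀ * vandermondeND x A) j α = moment x (Q.col j) α := by
  simp [mul_apply, vandermondeND, moment]

/-- The moments of the columns of `Q` are the entries of `R = Qᵀ V`; these are the ones below the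
diagonal. -/
theorem IsFullQR.moment_eq_zero (hQ : IsFullQR e (vandermondeND x (degLT d k)) Q) {j : Fin n}
    {α : Fin d → ℕ} (hα : mdeg α < k) (h : e.symm α < j) : moment x (Q.col j) α = 0 := by
  obtain ⟨hQQ, R, hR, hR0⟩ := hQ
  have h1 : Qᵀ * vandermondeND x (degLT d k) = R := by
    rw [hR, ← Matrix.mul_assoc]
    change Qᵀ * Q * R = R
    rw [show Qᵀ * Q = 1 from hQQ, Matrix.one_mul]
  rw [← hR0 j ⟨α, mem_degLT.2 hα⟩ h, ← h1, transpose_mul_vandermondeND_apply]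

/-- The graded order turns triangularity into annihilation of all lower-degree polynomials, whatever
the rank of `V`. -/
theorem IsFullQR.moment_eq_zero_of_lt (hQ : IsFullQR e (vandermondeND x (degLT d k)) Q)
    (he : IsGradedEnum e) (hn' : n ≤ (degLT d (k + 1)).card) {j : Fin n} {α : Fin d → ℕ}
    (h : mdeg α < mdeg (e j)) : moment x (Q.col j) α = 0 :=
  hQ.moment_eq_zero (h.trans_le (he.mdeg_le hn' j)) (by simpa using he.symm_lt h)

/-- The part of `Vᵀ Q` relating monomials and columns of the same degree. -/
noncomputable def gradedPart (e : ℕ ≃ (Fin d → ℕ)) (x : Fin n → Fin d → ℝ)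
    (Q : Matrix (Fin n) (Fin n) ℝ) (A : Finset (Fin d → ℕ)) : Matrix A (Fin n) ℝ :=
  Matrix.of fun α j => if mdeg α.1 = mdeg (e j) then moment x (Q.col j) α else 0

/-- The limit of the rescaled kernel matrix in the basis of the columns of `Q`. -/
noncomputable def limitMatrix (K : (Fin d → ℝ) → (Fin d → ℝ) → ℝ) (e : ℕ ≃ (Fin d → ℕ))
    (x : Fin n → Fin d → ℝ) (Q : Matrix (Fin n) (Fin n) ℝ) : Matrix (Fin n) (Fin n) ℝ :=
  Matrix.of fun i j => ∑ γ ∈ degEq d (mdeg (e i)), ∑ δ ∈ degEq d (mdeg (e j)),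
    moment x (Q.col i) γ * (kernelDeriv K γ δ 0 0 / ((mfact γ : ℝ) * mfact δ)) *
      moment x (Q.col j) δ

/-- The sets `A` and `B` only need to contain the relevant degree classes, since `gradedPart` kills
the other monomials. The same matrix can thus be read through Wronskian blocks of several shapes. -/
theorem limitMatrix_apply (K : (Fin d → ℝ) → (Fin d → ℝ) → ℝ) {A B : Finset (Fin d → ℕ)}
    {i j : Fin n} (hA : degEq d (mdeg (e i)) ⊆ A) (hB : degEq d (mdeg (e j)) ⊆ B) :
    limitMatrix K e x Q i j =
      ((gradedPart e x Q A)ᵀ * wronskianMatrix K A B * gradedPart e x Q B) i j := by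
  simp only [limitMatrix, mul_apply, Finset.sum_mul, transpose_apply, gradedPart, wronskianMatrix,
    Matrix.of_apply]
  rw [Finset.sum_comm, Finset.sum_coe_sort B fun δ => ∑ γ : A, (if mdeg γ.1 = mdeg (e i) then
    moment x (Q.col i) γ else 0) * (kernelDeriv K γ δ 0 0 / ((mfact γ.1 : ℝ) * mfact δ)) *
    if mdeg δ = mdeg (e j) then moment x (Q.col j) δ else 0]
  have h1 : ∀ δ, ∑ γ : A, (if mdeg γ.1 = mdeg (e i) then
      moment x (Q.col i) γ else 0) * (kernelDeriv K γ δ 0 0 / ((mfact γ.1 : ℝ) * mfact δ)) *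
      (if mdeg δ = mdeg (e j) then moment x (Q.col j) δ else 0) =
      ∑ γ ∈ degEq d (mdeg (e i)), moment x (Q.col i) γ *
        (kernelDeriv K γ δ 0 0 / ((mfact γ : ℝ) * mfact δ)) *
        if mdeg δ = mdeg (e j) then moment x (Q.col j) δ else 0 := by
    intro δ
    rw [Finset.sum_coe_sort A fun γ => (if mdeg γ = mdeg (e i) then moment x (Q.col i) γ else 0) *
      (kernelDeriv K γ δ 0 0 / ((mfact γ : ℝ) * mfact δ)) *
      if mdeg δ = mdeg (e j) then moment x (Q.col j) δ else 0, ← Finset.sum_subset hA]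
    · exact Finset.sum_congr rfl fun γ hγ => by rw [if_pos (mem_degEq.1 hγ)]
    · intro γ _ hγ
      rw [if_neg (fun h => hγ (mem_degEq.2 h)), zero_mul, zero_mul]
  simp only [h1]
  rw [← Finset.sum_subset hB]
  · exact Finset.sum_congr rfl fun δ hδ => by rw [if_pos (mem_degEq.1 hδ)]
  · intro δ _ hδ
    simp only [if_neg (fun h => hδ (mem_degEq.2 h)), mul_zero, Finset.sum_const_zero]

theorem limitMatrix_subBlock (K : (Fin d → ℝ) → (Fin d → ℝ) → ℝ) {A B : Finset (Fin d → ℕ)}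
    {p q : Fin n → Prop} (hA : ∀ i, p i → degEq d (mdeg (e i)) ⊆ A)
    (hB : ∀ i, q i → degEq d (mdeg (e i)) ⊆ B) :
    (limitMatrix K e x Q).subBlock p q = ((gradedPart e x Q A).submatrix id Subtype.val)ᵀ *
      wronskianMatrix K A B * (gradedPart e x Q B).submatrix id Subtype.val := by
  ext i j
  change limitMatrix K e x Q i j = _
  rw [limitMatrix_apply K (hA i i.2) (hB j j.2)]
  rfl

theorem degEq_subset_degLT {r s : ℕ} (h : r < s) : degEq d r ⊆ degLT d s := by
  intro α hα
  rw [mem_degEq] at hα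
  rw [mem_degLT, hα]
  exact h

/-- The product of the diagonal entries of the triangular factor. -/
noncomputable def diagProd (e : ℕ ≃ (Fin d → ℕ)) (x : Fin n → Fin d → ℝ)
    (Q : Matrix (Fin n) (Fin n) ℝ) (p : Fin n → Prop) [DecidablePred p] : ℝ :=
  ∏ j : {j // p j}, moment x (Q.col j) (e j)

theorem diagProd_succ (s : ℕ) : diagProd e x Q (fun j => mdeg (e j) < s + 1) =
    diagProd e x Q (fun j => mdeg (e j) < s) * diagProd e x Q (fun j => mdeg (e j) = s) := by
  have h : ∀ (p : Fin n → Prop) [DecidablePred p], diagProd e x Q p =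
      ∏ j, if p j then moment x (Q.col j) (e j) else 1 := by
    intro p _
    rw [diagProd, ← Finset.prod_filter]
    exact (Finset.prod_subtype (Finset.univ.filter p) (by simp)
      fun j => moment x (Q.col j) (e j)).symm
  rw [h, h, h, ← Finset.prod_mul_distrib]
  refine Finset.prod_congr rfl fun j _ => ?_
  split_ifs <;> first | omega | simp

/-- Rows are monomials and columns are positions, so this is a truncation of `Rᵀ`: lower triangular,
with the diagonal of `R`. -/
theorem det_gradedPart_lt (hQ : IsFullQR e (vandermondeND x (degLT d k)) Q) (he : IsGradedEnum e)
    (hn : (degLT d k).card < n) {s : ℕ} (hs : s ≤ k) :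
    ((gradedPart e x Q (degLT d s)).submatrix (ltEquiv he hn hs) Subtype.val).det =
      diagProd e x Q (fun j => mdeg (e j) < s) := by
  rw [det_of_isLowerTriangular]
  · exact Finset.prod_congr rfl fun j _ => by simp [gradedPart, ltEquiv]
  · rintro ⟨i, hi⟩ ⟨j, hj⟩ hij
    have hij' : i < j := by simpa using hij
    simp only [gradedPart, ltEquiv, submatrix_apply, Equiv.coe_fn_mk, Matrix.of_apply]
    rw [hQ.moment_eq_zero (hi.trans_le hs) (by simpa using hij'), ite_self]

theorem det_gradedPart_eq (hQ : IsFullQR e (vandermondeND x (degLT d k)) Q) (he : IsGradedEnum e)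
    (hn : (degLT d k).card < n) {s : ℕ} (hs : s < k) :
    ((gradedPart e x Q (degEq d s)).submatrix (eqEquiv he hn hs) Subtype.val).det =
      diagProd e x Q (fun j => mdeg (e j) = s) := by
  rw [det_of_isLowerTriangular]
  · exact Finset.prod_congr rfl fun j _ => by simp [gradedPart, eqEquiv]
  · rintro ⟨i, hi⟩ ⟨j, hj⟩ hij
    have hij' : i < j := by simpa using hij
    simp only [gradedPart, eqEquiv, submatrix_apply, Equiv.coe_fn_mk, Matrix.of_apply]
    rw [hQ.moment_eq_zero (hi.trans_lt hs) (by simpa using hij'), ite_self]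

/-- Orthogonality of `Q` gives `Vᵀ V = Rᵀ R`; the rows of `R` at positions of degree `≥ s` vanish,
and the remaining square block is triangular. -/
theorem det_gram_vandermondeND (hQ : IsFullQR e (vandermondeND x (degLT d k)) Q)
    (he : IsGradedEnum e) (hn : (degLT d k).card < n) {s : ℕ} (hs : s ≤ k) :
    ((vandermondeND x (degLT d s))ᵀ * vandermondeND x (degLT d s)).det =
      diagProd e x Q (fun j => mdeg (e j) < s) ^ 2 := by
  set V := vandermondeND x (degLT d s)
  have hQQ : Q * Qᵀ = 1 := mul_eq_one_comm.1 hQ.1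
  let N : Matrix {j : Fin n // mdeg (e j) < s} {j : Fin n // mdeg (e j) < s} ℝ :=
    (Qᵀ * V).submatrix Subtype.val (ltEquiv he hn hs)
  have hN : N.det = diagProd e x Q (fun j => mdeg (e j) < s) := by
    rw [det_of_isUpperTriangular]
    · exact Finset.prod_congr rfl fun j _ => by
        simp only [N, submatrix_apply, V, transpose_mul_vandermondeND_apply]
        rfl
    · rintro ⟨i, hi⟩ ⟨j, hj⟩ hij
      have hij' : j < i := by simpa using hij
      simp only [N, submatrix_apply, V, transpose_mul_vandermondeND_apply]
      exact hQ.moment_eq_zero (hj.trans_le hs) (by simpa [ltEquiv] using hij')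
  have hV : Vᵀ * V = (Qᵀ * V)ᵀ * (Qᵀ * V) := by
    rw [transpose_mul, transpose_transpose, Matrix.mul_assoc, ← Matrix.mul_assoc Q, hQQ,
      Matrix.one_mul]
  have hNN : (Vᵀ * V).submatrix (ltEquiv he hn hs) (ltEquiv he hn hs) = Nᵀ * N := by
    ext i j
    rw [hV, submatrix_apply, mul_apply, mul_apply]
    simp only [transpose_apply, N, submatrix_apply]
    refine Fintype.sum_eq_sum_subtype_of_eq_zero _ fun l hl => ?_
    rw [transpose_mul_vandermondeND_apply, hQ.moment_eq_zero, zero_mul]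
    · exact (mem_degLT.1 (ltEquiv he hn hs i).2).trans_le hs
    · have := he.symm_lt ((mem_degLT.1 (ltEquiv he hn hs i).2).trans_le (not_lt.1 hl))
      simpa using this
  rw [← det_submatrix_equiv_self (ltEquiv he hn hs), hNN, det_mul, det_transpose, hN, sq]

theorem det_ne_zero_of_rank_eq_card {ι : Type*} [Fintype ι] [DecidableEq ι] {A : Matrix ι ι ℝ}
    (h : A.rank = Fintype.card ι) : A.det ≠ 0 := by
  have h1 : LinearMap.range A.mulVecLin = ⊤ :=
    Submodule.eq_top_of_finrank_eq (by rw [← Matrix.rank, h, Module.finrank_fintype_fun_eq_card])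
  have h2 : Function.Surjective A.mulVec := LinearMap.range_eq_top.1 h1
  rw [mulVec_surjective_iff_isUnit, isUnit_iff_isUnit_det] at h2
  exact h2.ne_zero

theorem diagProd_ne_zero (hQ : IsFullQR e (vandermondeND x (degLT d k)) Q)
    (he : IsGradedEnum e) (hn : (degLT d k).card < n) {s : ℕ} (hs : s ≤ k)
    (hV : IsFullRank (vandermondeND x (degLT d s))) :
    diagProd e x Q (fun j => mdeg (e j) < s) ≠ 0 := by
  have hcard : (degLT d s).card ≤ n := by
    refine (Finset.card_le_card fun α hα => ?_).trans hn.le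
    rw [mem_degLT] at hα ⊢
    omega
  have h1 : ((vandermondeND x (degLT d s))ᵀ * vandermondeND x (degLT d s)).det ≠ 0 := by
    refine det_ne_zero_of_rank_eq_card ?_
    rw [rank_transpose_mul_self, hV, Fintype.card_fin, Fintype.card_coe, min_eq_right hcard]
  rw [det_gram_vandermondeND hQ he hn hs] at h1
  exact fun h => h1 (by rw [h]; simp)

end Graded

/-! ### Schur complements of the limit matrix. -/

section GroupMatrix

open Matrix

variable {d n k : ℕ} {e : ℕ ≃ (Fin d → ℕ)} {x : Fin n → Fin d → ℝ} {Q : Matrix (Fin n) (Fin n) ℝ}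
  {K : (Fin d → ℝ) → (Fin d → ℝ) → ℝ}

theorem Matrix.mul_eq_submatrix_mul_submatrix {l m a o : Type*} [Fintype a] [Fintype m]
    (E : a ≃ m) (A : Matrix l m ℝ) (B : Matrix m o ℝ) :
    A * B = A.submatrix id E * B.submatrix E id := by
  rw [submatrix_mul_equiv, submatrix_id_id]

theorem limitMatrix_subBlock_lt (he : IsGradedEnum e) (hn : (degLT d k).card < n) {s : ℕ}
    (hs : s ≤ k) :
    (limitMatrix K e x Q).subBlock (fun j => mdeg (e j) < s) (fun j => mdeg (e j) < s) =
      ((gradedPart e x Q (degLT d s)).submatrix (ltEquiv he hn hs) Subtype.val)ᵀ *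
      (wronskianMatrix K (degLT d s) (degLT d s)).submatrix (ltEquiv he hn hs) (ltEquiv he hn hs) *
      (gradedPart e x Q (degLT d s)).submatrix (ltEquiv he hn hs) Subtype.val := by
  rw [limitMatrix_subBlock K (A := degLT d s) (B := degLT d s) (fun i => degEq_subset_degLT)
    (fun i => degEq_subset_degLT), mul_eq_submatrix_mul_submatrix (ltEquiv he hn hs),
    mul_eq_submatrix_mul_submatrix (ltEquiv he hn hs)
      ((gradedPart e x Q (degLT d s)).submatrix id Subtype.val)ᵀ]
  rfl

theorem limitMatrix_subBlock_lt_eq (he : IsGradedEnum e) (hn : (degLT d k).card < n) {s : ℕ}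
    (hs : s ≤ k) :
    (limitMatrix K e x Q).subBlock (fun j => mdeg (e j) < s) (fun j => mdeg (e j) = s) =
      ((gradedPart e x Q (degLT d s)).submatrix (ltEquiv he hn hs) Subtype.val)ᵀ *
      (wronskianMatrix K (degLT d s) (degEq d s)).submatrix (ltEquiv he hn hs) id *
      (gradedPart e x Q (degEq d s)).submatrix id Subtype.val := by
  rw [limitMatrix_subBlock K (A := degLT d s) (B := degEq d s) (fun i => degEq_subset_degLT)
    (fun i hi => by rw [hi]),
    mul_eq_submatrix_mul_submatrix (ltEquiv he hn hs)
      ((gradedPart e x Q (degLT d s)).submatrix id Subtype.val)ᵀ]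
  rfl

theorem limitMatrix_subBlock_eq_lt (he : IsGradedEnum e) (hn : (degLT d k).card < n) {s : ℕ}
    (hs : s ≤ k) :
    (limitMatrix K e x Q).subBlock (fun j => mdeg (e j) = s) (fun j => mdeg (e j) < s) =
      ((gradedPart e x Q (degEq d s)).submatrix id Subtype.val)ᵀ *
      (wronskianMatrix K (degEq d s) (degLT d s)).submatrix id (ltEquiv he hn hs) *
      (gradedPart e x Q (degLT d s)).submatrix (ltEquiv he hn hs) Subtype.val := by
  rw [limitMatrix_subBlock K (A := degEq d s) (B := degLT d s) (fun i hi => by rw [hi])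
    (fun i => degEq_subset_degLT), mul_eq_submatrix_mul_submatrix (ltEquiv he hn hs)]
  rfl

theorem limitMatrix_subBlock_eq_eq (s : ℕ) :
    (limitMatrix K e x Q).subBlock (fun j => mdeg (e j) = s) (fun j => mdeg (e j) = s) =
      ((gradedPart e x Q (degEq d s)).submatrix id Subtype.val)ᵀ *
      wronskianMatrix K (degEq d s) (degEq d s) *
      (gradedPart e x Q (degEq d s)).submatrix id Subtype.val :=
  limitMatrix_subBlock K (fun i hi => by rw [hi]) (fun i hi => by rw [hi])

theorem det_limitMatrix_subBlock_lt (hQ : IsFullQR e (vandermondeND x (degLT d k)) Q)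
    (he : IsGradedEnum e) (hn : (degLT d k).card < n) {s : ℕ} (hs : s ≤ k) :
    ((limitMatrix K e x Q).subBlock (fun j => mdeg (e j) < s) (fun j => mdeg (e j) < s)).det =
      diagProd e x Q (fun j => mdeg (e j) < s) ^ 2 *
        (wronskianMatrix K (degLT d s) (degLT d s)).det := by
  rw [limitMatrix_subBlock_lt he hn hs, det_mul, det_mul, det_transpose,
    det_gradedPart_lt hQ he hn hs, det_submatrix_equiv_self]
  ring

theorem gradedPart_submatrix_eq (s : ℕ) :
    (gradedPart e x Q (degEq d s)).submatrix id
      (Subtype.val : {j : Fin n // mdeg (e j) = s} → Fin n) =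
      (vandermondeND x (degEq d s))ᵀ * blockQ e Q s := by
  ext α j
  simp only [gradedPart, submatrix_apply, id_eq, Matrix.of_apply, mul_apply, transpose_apply,
    vandermondeND, blockQ, moment, col_apply]
  rw [if_pos ((mem_degEq.1 α.2).trans j.2.symm)]
  exact Finset.sum_congr rfl fun i _ => mul_comm _ _

/-- Up to degree `s` the limit matrix is a congruence of the Wronskian by a block-diagonal matrix.
Its invertible lower-degree block `T` cancels against its inverse in the Schur complement; the
degree-`s` block may be rectangular. -/
theorem gradedSchur_limitMatrix (hQ : IsFullQR e (vandermondeND x (degLT d k)) Q)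
    (he : IsGradedEnum e) (hn : (degLT d k).card < n) {s : ℕ} (hs : s ≤ k)
    (hD : diagProd e x Q (fun j => mdeg (e j) < s) ≠ 0) :
    gradedSchur (fun j : Fin n => mdeg (e j)) (limitMatrix K e x Q) s =
      ((gradedPart e x Q (degEq d s)).submatrix id Subtype.val)ᵀ * wronskianSchur K s *
        (gradedPart e x Q (degEq d s)).submatrix id Subtype.val := by
  set E := ltEquiv he hn hs
  set T := (gradedPart e x Q (degLT d s)).submatrix E Subtype.val with hT
  set W := wronskianMatrix K (degLT d s) (degLT d s) with hWdef
  have hTd : IsUnit T.det := by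
    rw [hT, det_gradedPart_lt hQ he hn hs]
    exact isUnit_iff_ne_zero.2 hD
  have hTd' : IsUnit Tᵀ.det := by rwa [det_transpose]
  rw [gradedSchur, limitMatrix_subBlock_lt he hn hs, limitMatrix_subBlock_lt_eq he hn hs,
    limitMatrix_subBlock_eq_lt he hn hs, limitMatrix_subBlock_eq_eq, ← hWdef, ← hT,
    Matrix.mul_inv_rev, Matrix.mul_inv_rev, inv_submatrix_equiv, wronskianSchur, Matrix.mul_sub, Matrix.sub_mul,
    ← hWdef]
  congr 1
  set S := (gradedPart e x Q (degEq d s)).submatrix id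
    (Subtype.val : {j : Fin n // mdeg (e j) = s} → Fin n)
  set W₁ := wronskianMatrix K (degEq d s) (degLT d s)
  set W₂ := wronskianMatrix K (degLT d s) (degEq d s)
  calc Sᵀ * W₁.submatrix id E * T * (T⁻¹ * (W⁻¹.submatrix E E * Tᵀ⁻¹)) *
        (Tᵀ * W₂.submatrix E id * S)
      = Sᵀ * W₁.submatrix id E * (T * T⁻¹) * W⁻¹.submatrix E E * (Tᵀ⁻¹ * Tᵀ) *
        W₂.submatrix E id * S := by simp only [Matrix.mul_assoc]
    _ = Sᵀ * (W₁.submatrix id E * W⁻¹.submatrix E E * W₂.submatrix E id) * S := by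
        rw [mul_nonsing_inv _ hTd, nonsing_inv_mul _ hTd', Matrix.mul_one, Matrix.mul_one]
        simp only [Matrix.mul_assoc]
    _ = Sᵀ * (W₁ * W⁻¹ * W₂) * S := by
        rw [submatrix_mul_equiv, submatrix_mul_equiv, submatrix_id_id]

theorem gradedSchur_eq_groupMatrix (hQ : IsFullQR e (vandermondeND x (degLT d k)) Q)
    (he : IsGradedEnum e) (hn : (degLT d k).card < n) {s : ℕ} (hs : s ≤ k)
    (hD : diagProd e x Q (fun j => mdeg (e j) < s) ≠ 0) :
    gradedSchur (fun j : Fin n => mdeg (e j)) (limitMatrix K e x Q) s = groupMatrix K x e Q s := by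
  rw [gradedSchur_limitMatrix hQ he hn hs hD, gradedPart_submatrix_eq, transpose_mul,
    transpose_transpose, groupMatrix]
  simp only [Matrix.mul_assoc]

/-- For `s < k` every monomial of degree `s` has a position (`eqEquiv`), so the outer factors are
square and determinants multiply. -/
theorem det_gradedSchur (hQ : IsFullQR e (vandermondeND x (degLT d k)) Q)
    (he : IsGradedEnum e) (hn : (degLT d k).card < n) {s : ℕ} (hs : s < k)
    (hD : diagProd e x Q (fun j => mdeg (e j) < s) ≠ 0) :
    (gradedSchur (fun j : Fin n => mdeg (e j)) (limitMatrix K e x Q) s).det =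
      diagProd e x Q (fun j => mdeg (e j) = s) ^ 2 * (wronskianSchur K s).det := by
  rw [gradedSchur_limitMatrix hQ he hn hs.le hD,
    mul_eq_submatrix_mul_submatrix (eqEquiv he hn hs), mul_eq_submatrix_mul_submatrix
      (eqEquiv he hn hs) ((gradedPart e x Q (degEq d s)).submatrix id Subtype.val)ᵀ]
  have h := det_gradedPart_eq hQ he hn hs
  rw [← det_submatrix_equiv_self (eqEquiv he hn hs) (wronskianSchur K s), ← h]
  change ((((gradedPart e x Q (degEq d s)).submatrix (eqEquiv he hn hs) Subtype.val)ᵀ *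
    (wronskianSchur K s).submatrix (eqEquiv he hn hs) (eqEquiv he hn hs)) *
    (gradedPart e x Q (degEq d s)).submatrix (eqEquiv he hn hs) Subtype.val).det = _
  rw [det_mul, det_mul, det_transpose]
  ring

/-- Multi-indices of degree `≤ s` are those of degree `< s` and those of degree `s`. -/
noncomputable def degLTSuccEquiv (d s : ℕ) : degLT d s ⊕ degEq d s ≃ degLT d (s + 1) :=
  Equiv.ofBijective (Sum.elim
    (fun α => ⟨α.1, mem_degLT.2 ((mem_degLT.1 α.2).trans (Nat.lt_succ_self s))⟩)
    (fun α => ⟨α.1, mem_degLT.2 ((mem_degEq.1 α.2).trans_lt (Nat.lt_succ_self s))⟩)) <| by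
    constructor
    · rintro (⟨α, hα⟩ | ⟨α, hα⟩) (⟨β, hβ⟩ | ⟨β, hβ⟩) h <;>
        simp only [Sum.elim_inl, Sum.elim_inr, Subtype.mk.injEq] at h <;> subst h <;>
        first
        | rfl
        | (simp only [mem_degEq, mem_degLT] at hα hβ; omega)
    · rintro ⟨α, hα⟩
      rw [mem_degLT] at hα
      rcases Nat.lt_succ_iff_lt_or_eq.1 hα with h | h
      · exact ⟨.inl ⟨α, mem_degLT.2 h⟩, rfl⟩
      · exact ⟨.inr ⟨α, mem_degEq.2 h⟩, rfl⟩

theorem det_wronskianMatrix_succ {s : ℕ}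
    (hW : (wronskianMatrix K (degLT d s) (degLT d s)).det ≠ 0) :
    (wronskianMatrix K (degLT d (s + 1)) (degLT d (s + 1))).det =
      (wronskianMatrix K (degLT d s) (degLT d s)).det * (wronskianSchur K s).det := by
  have : Invertible (wronskianMatrix K (degLT d s) (degLT d s)) :=
    invertibleOfIsUnitDet _ (isUnit_iff_ne_zero.2 hW)
  have h : (wronskianMatrix K (degLT d (s + 1)) (degLT d (s + 1))).submatrix (degLTSuccEquiv d s)
      (degLTSuccEquiv d s) = fromBlocks (wronskianMatrix K (degLT d s) (degLT d s))
        (wronskianMatrix K (degLT d s) (degEq d s)) (wronskianMatrix K (degEq d s) (degLT d s))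
        (wronskianMatrix K (degEq d s) (degEq d s)) := by
    ext (α | α) (β | β) <;> rfl
  rw [← det_submatrix_equiv_self (degLTSuccEquiv d s), h, det_fromBlocks₁₁, invOf_eq_nonsing_inv]
  rfl

end GroupMatrix

/-! ### Counting squared entries of orthogonal matrices. -/

section Orthogonal

open Matrix

variable {n : ℕ}

theorem sum_sq_row {O : Matrix (Fin n) (Fin n) ℝ} (hO : Oᵀ * O = 1) (i : Fin n) :
    ∑ j, O i j ^ 2 = 1 := by
  have h := congrFun (congrFun (mul_eq_one_comm.1 hO : O * Oᵀ = 1) i) i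
  rw [mul_apply, one_apply_eq] at h
  rw [← h]
  exact Finset.sum_congr rfl fun j _ => by rw [transpose_apply, sq]

theorem sum_sq_col {O : Matrix (Fin n) (Fin n) ℝ} (hO : Oᵀ * O = 1) (j : Fin n) :
    ∑ i, O i j ^ 2 = 1 := by
  have h := congrFun (congrFun hO j) j
  rw [mul_apply, one_apply_eq] at h
  rw [← h]
  exact Finset.sum_congr rfl fun i _ => by rw [transpose_apply, sq]

/-- An orthogonal block triangular matrix with square diagonal blocks is block diagonal. -/
theorem orthogonal_eq_zero_of_triangular {O : Matrix (Fin n) (Fin n) ℝ} (hO : Oᵀ * O = 1)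
    (p : Fin n → Prop) [DecidablePred p] (h : ∀ i j, ¬ p i → p j → O i j = 0) :
    ∀ i j, p i → ¬ p j → O i j = 0 := by
  -- The columns in `p` put all their squared mass in the rows of `p`. That already equals the total
  -- mass of these rows, so nothing is left for the other columns.
  have h1 : ∑ i with p i, ∑ j with p j, O i j ^ 2 = (Finset.univ.filter p).card := by
    rw [Finset.sum_comm, Finset.card_eq_sum_ones, Nat.cast_sum]
    refine Finset.sum_congr rfl fun j hj => ?_
    have hj' : p j := (Finset.mem_filter.1 hj).2
    rw [Nat.cast_one, ← sum_sq_col hO j]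
    refine Finset.sum_subset (Finset.filter_subset _ _) fun i _ hi => ?_
    rw [h i j (by simpa using hi) hj']
    simp
  have h2 : ∑ i with p i, ∑ j with ¬ p j, O i j ^ 2 = 0 := by
    have h3 : ∑ i with p i, (∑ j with p j, O i j ^ 2 + ∑ j with ¬ p j, O i j ^ 2) =
        (Finset.univ.filter p).card := by
      rw [Finset.card_eq_sum_ones, Nat.cast_sum]
      refine Finset.sum_congr rfl fun i _ => ?_
      rw [Finset.sum_filter_add_sum_filter_not, sum_sq_row hO, Nat.cast_one]
    rw [Finset.sum_add_distrib, h1] at h3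
    linarith
  intro i j hi hj
  rw [Finset.sum_eq_zero_iff_of_nonneg fun i _ => by positivity] at h2
  have h4 := h2 i (by simpa using hi)
  rw [Finset.sum_eq_zero_iff_of_nonneg fun i _ => by positivity] at h4
  simpa using h4 j (by simpa using hj)

/-- Orthonormal vectors inside a coordinate subspace are at most as many as its coordinates. -/
theorem card_le_of_orthogonal {O : Matrix (Fin n) (Fin n) ℝ} (hO : Oᵀ * O = 1)
    {I J : Finset (Fin n)} (h : ∀ i ∉ I, ∀ j ∈ J, O i j = 0) : J.card ≤ I.card := by
  have h1 : ∑ j ∈ J, ∑ i ∈ I, O i j ^ 2 = J.card := by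
    rw [Finset.card_eq_sum_ones, Nat.cast_sum]
    refine Finset.sum_congr rfl fun j hj => ?_
    rw [Nat.cast_one, ← sum_sq_col hO j]
    exact Finset.sum_subset (Finset.subset_univ _) fun i _ hi => by rw [h i hi j hj]; simp
  have h2 : ∑ i ∈ I, ∑ j ∈ J, O i j ^ 2 ≤ I.card := by
    rw [Finset.card_eq_sum_ones, Nat.cast_sum]
    refine Finset.sum_le_sum fun i _ => ?_
    rw [Nat.cast_one, ← sum_sq_row hO i]
    exact Finset.sum_le_sum_of_subset_of_nonneg (Finset.subset_univ _) fun j _ _ => sq_nonneg _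
  rw [Finset.sum_comm, h1] at h2
  exact_mod_cast h2

end Orthogonal

/-! ### Orthogonality forced by positivity. -/

section Vanishing

open Matrix

variable {n : ℕ}

theorem quadForm_projector_nonneg {P : Matrix (Fin n) (Fin n) ℝ} (hs : P.IsSymm)
    (hi : P * P = P) (u : Fin n → ℝ) : 0 ≤ u ⬝ᵥ P *ᵥ u := by
  have : u ⬝ᵥ P *ᵥ u = (P *ᵥ u) ⬝ᵥ (P *ᵥ u) := by
    conv_lhs => rw [← hi, ← mulVec_mulVec, dotProduct_mulVec, ← mulVec_transpose, hs.eq]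
  rw [this]
  exact Finset.sum_nonneg fun i _ => mul_self_nonneg _

/-- A vector on which the form of a positive semidefinite analytic family decays fast is
orthogonal to the limiting eigenvectors of the slowly decaying eigenvalues. -/
theorem IsAnalyticEVD.quadForm_eq_zero {A : ℝ → Matrix (Fin n) (Fin n) ℝ} {lam : Fin n → ℝ → ℝ}
    {P : Fin n → ℝ → Matrix (Fin n) (Fin n) ℝ} (h : IsAnalyticEVD A lam P) {ε₀ : ℝ}
    (hε₀ : 0 < ε₀) (hpsd : ∀ ε ∈ Set.Icc 0 ε₀, (A ε).PosSemidef) {u : Fin n → ℝ} {c : ℝ} {m : ℕ}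
    (hu : Tendsto (fun ε => (u ⬝ᵥ A ε *ᵥ u) / ε ^ m) (𝓝[≠] 0) (𝓝 c)) {j : Fin n} {o : ℕ} {g : ℝ}
    (hg : g ≠ 0) (hlam : Tendsto (fun ε => lam j ε / ε ^ o) (𝓝[≠] 0) (𝓝 g)) (ho : o < m) :
    u ⬝ᵥ P j 0 *ᵥ u = 0 := by
  -- Positive semidefiniteness is given only for `ε ≥ 0`, hence the one-sided limits.
  have le1 : 𝓝[>] (0 : ℝ) ≤ 𝓝[≠] 0 := nhdsWithin_mono _ fun x hx => ne_of_gt hx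
  have le2 : 𝓝[>] (0 : ℝ) ≤ 𝓝 0 := nhdsWithin_le_nhds
  have hq : Tendsto (fun ε => u ⬝ᵥ P j ε *ᵥ u) (𝓝[>] 0) (𝓝 (u ⬝ᵥ P j 0 *ᵥ u)) := by
    refine Tendsto.mono_left ?_ le2
    refine tendsto_finsetSum _ fun a _ => Tendsto.const_mul _ ?_
    simp only [mulVec, dotProduct]
    exact tendsto_finsetSum _ fun b _ => ((h.analytic_P j a b).continuousAt.tendsto).mul_const _
  have h1 : Tendsto (fun ε => lam j ε / ε ^ o * (u ⬝ᵥ P j ε *ᵥ u)) (𝓝[>] 0)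
      (𝓝 (g * (u ⬝ᵥ P j 0 *ᵥ u))) := (hlam.mono_left le1).mul hq
  have h2 : Tendsto (fun ε => (u ⬝ᵥ A ε *ᵥ u) / ε ^ m * ε ^ (m - o)) (𝓝[>] 0) (𝓝 0) := by
    have hp : Tendsto (fun ε : ℝ => ε ^ (m - o)) (𝓝[>] 0) (𝓝 (0 ^ (m - o))) :=
      ((continuous_pow (m - o)).tendsto 0).mono_left le2
    rw [zero_pow (by omega)] at hp
    simpa using (hu.mono_left le1).mul hp
  have hIcc : ∀ᶠ ε in 𝓝[>] (0 : ℝ), ε ∈ Set.Ioc 0 ε₀ := Ioc_mem_nhdsGT hε₀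
  have hbd : ∀ᶠ ε in 𝓝[>] (0 : ℝ), 0 ≤ lam j ε / ε ^ o * (u ⬝ᵥ P j ε *ᵥ u) ∧
      lam j ε / ε ^ o * (u ⬝ᵥ P j ε *ᵥ u) ≤ (u ⬝ᵥ A ε *ᵥ u) / ε ^ m * ε ^ (m - o) := by
    filter_upwards [hIcc, h.isSymm.filter_mono le2, h.isIdempotent.filter_mono le2,
      h.rank_eq_one.filter_mono le2, h.orthogonal.filter_mono le2, h.eq_sum.filter_mono le2]
      with ε hε hs hi hr ho' hsum
    have hpos : 0 < ε := hε.1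
    have hA := hpsd ε ⟨hε.1.le, hε.2⟩
    have hnn : ∀ i, 0 ≤ lam i ε := by
      intro i
      obtain ⟨p, hp, hP⟩ := exists_eq_vecMulVec_of_trace_eq_one (hs i) (hi i) (by
        rw [trace_eq_rank_of_idempotent (hi i), hr i, Nat.cast_one])
      have h3 := hA.dotProduct_mulVec_nonneg p
      have h4 : A ε *ᵥ p = lam i ε • p := by
        have hpp : p = P i ε *ᵥ p := by
          rw [hP, vecMulVec_mulVec, hp]; simp
        have h5 : A ε * P i ε = lam i ε • P i ε := by
          rw [hsum, Finset.sum_mul, Finset.sum_eq_single i]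
          · rw [smul_mul_assoc, hi i]
          · intro l _ hl
            rw [smul_mul_assoc, ho' l i hl, smul_zero]
          · simp
        conv_lhs => rw [hpp, mulVec_mulVec, h5, smul_mulVec, ← hpp]
      rw [h4, star_trivial, dotProduct_smul, hp, smul_eq_mul, mul_one] at h3
      exact h3
    have hform : u ⬝ᵥ A ε *ᵥ u = ∑ i, lam i ε * (u ⬝ᵥ P i ε *ᵥ u) := by
      rw [hsum, sum_mulVec, dotProduct_sum]
      exact Finset.sum_congr rfl fun i _ => by rw [smul_mulVec, dotProduct_smul, smul_eq_mul]
    have hqn : ∀ i, 0 ≤ u ⬝ᵥ P i ε *ᵥ u := fun i => quadForm_projector_nonneg (hs i) (hi i) u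
    -- Every term of the spectral sum is nonnegative, so no cancellation can hide a large one.
    -- Dividing by `ε ^ o` with `o < m` sends the upper bound to zero.
    have hle : lam j ε * (u ⬝ᵥ P j ε *ᵥ u) ≤ u ⬝ᵥ A ε *ᵥ u := by
      rw [hform]
      exact Finset.single_le_sum (f := fun i => lam i ε * (u ⬝ᵥ P i ε *ᵥ u))
        (fun i _ => mul_nonneg (hnn i) (hqn i)) (Finset.mem_univ j)
    refine ⟨mul_nonneg (div_nonneg (hnn j) (by positivity)) (hqn j), ?_⟩
    have e1 : (u ⬝ᵥ A ε *ᵥ u) / ε ^ m * ε ^ (m - o) = (u ⬝ᵥ A ε *ᵥ u) / ε ^ o := by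
      have : ε ^ m = ε ^ o * ε ^ (m - o) := by rw [← pow_add]; congr 1; omega
      rw [this]
      field_simp
    rw [e1, div_mul_eq_mul_div]
    gcongr
  have h3 := squeeze_zero' (hbd.mono fun ε hε => hε.1) (hbd.mono fun ε hε => hε.2) h2
  exact (mul_eq_zero.1 (tendsto_nhds_unique h1 h3)).resolve_left hg

end Vanishing

/-! ### Orders of eigenvalues, main terms and limiting eigenvectors. -/

section Kernel

open Matrix

variable {d n k : ℕ} {e : ℕ ≃ (Fin d → ℕ)} {Ω : Set (Fin d → ℝ)}
  {K : (Fin d → ℝ) → (Fin d → ℝ) → ℝ} {x : Fin n → Fin d → ℝ} {Q : Matrix (Fin n) (Fin n) ℝ}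
  {lam : Fin n → ℝ → ℝ} {P : Fin n → ℝ → Matrix (Fin n) (Fin n) ℝ}

theorem tendsto_transpose_mul_kernelMatrix_mul (he : IsGradedEnum e)
    (hn' : n ≤ (degLT d (k + 1)).card) (hΩ : IsOpen Ω) (hΩ0 : (0 : Fin d → ℝ) ∈ Ω)
    (hK : IsCmm (k + 1) Ω K) (hQ : IsFullQR e (vandermondeND x (degLT d k)) Q) (i j : Fin n) :
    Tendsto (fun ε => (Qᵀ * kernelMatrix K x ε * Q) i j / ε ^ (mdeg (e i) + mdeg (e j))) (𝓝[≠] 0)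
      (𝓝 (limitMatrix K e x Q i j)) := by
  have hi := he.mdeg_le hn' i
  have hj := he.mdeg_le hn' j
  have h := tendsto_kernelMatrix_form hΩ hΩ0 hK x (u := Q.col i) (v := Q.col j)
    (s := mdeg (e i)) (t := mdeg (e j)) (by omega) (by omega)
    (fun α hα => hQ.moment_eq_zero_of_lt he hn' hα) (fun α hα => hQ.moment_eq_zero_of_lt he hn' hα)
  refine h.congr fun ε => ?_
  congr 1
  simp only [mul_apply, Finset.sum_mul, transpose_apply, col_apply]
  rw [Finset.sum_comm]
  exact Finset.sum_congr rfl fun a _ => Finset.sum_congr rfl fun b _ => by ring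

theorem dotProduct_kernelMatrix_mulVec (ε : ℝ) (i : Fin n) :
    Q.col i ⬝ᵥ kernelMatrix K x ε *ᵥ Q.col i = (Qᵀ * kernelMatrix K x ε * Q) i i := by
  rw [Matrix.mul_assoc]
  rfl

/-- Limiting eigenvectors of eigenvalues of order `o` are orthogonal to the columns of `Q` of
degree `> o / 2`. -/
theorem IsAnalyticEVD.col_dotProduct_eq_zero (he : IsGradedEnum e)
    (hn' : n ≤ (degLT d (k + 1)).card) (hΩ : IsOpen Ω) (hΩ0 : (0 : Fin d → ℝ) ∈ Ω)
    (hK : IsCmm (k + 1) Ω K) (hQ : IsFullQR e (vandermondeND x (degLT d k)) Q) {ε₀ : ℝ}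
    (hε₀ : 0 < ε₀) (hpsd : ∀ ε ∈ Set.Icc 0 ε₀, (kernelMatrix K x ε).PosSemidef)
    (h : IsAnalyticEVD (kernelMatrix K x) lam P) {p : Fin n → ℝ} {i j : Fin n}
    (hp : P j 0 = vecMulVec p p) {o : ℕ} {g : ℝ} (hg : g ≠ 0)
    (hlam : Tendsto (fun ε => lam j ε / ε ^ o) (𝓝[≠] 0) (𝓝 g)) (ho : o < 2 * mdeg (e i)) :
    Q.col i ⬝ᵥ p = 0 := by
  have h1 := tendsto_transpose_mul_kernelMatrix_mul he hn' hΩ hΩ0 hK hQ i i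
  simp only [← dotProduct_kernelMatrix_mulVec, ← two_mul] at h1
  have h2 := h.quadForm_eq_zero hε₀ hpsd h1 hg hlam ho
  rw [hp, vecMulVec_mulVec] at h2
  simp only [op_smul_eq_smul, dotProduct_smul, smul_eq_mul] at h2
  rw [dotProduct_comm p] at h2
  exact mul_self_eq_zero.1 h2

theorem exists_labelling (he : IsGradedEnum e) (hn' : n ≤ (degLT d (k + 1)).card)
    (hΩ : IsOpen Ω) (hΩ0 : (0 : Fin d → ℝ) ∈ Ω) (hK : IsCmm (k + 1) Ω K)
    (hQ : IsFullQR e (vandermondeND x (degLT d k)) Q) {ε₀ : ℝ} (hε₀ : 0 < ε₀)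
    (hpsd : ∀ ε ∈ Set.Icc 0 ε₀, (kernelMatrix K x ε).PosSemidef)
    (h : IsAnalyticEVD (kernelMatrix K x) lam P) :
    ∃ (σ : Equiv.Perm (Fin n)) (μ : Fin n → ℝ), HasMainTerms e (fun j => lam (σ j)) μ := by
  obtain ⟨U, hU, hP⟩ := exists_orthogonal_of_projectors h.isSymm.self_of_nhds
    h.isIdempotent.self_of_nhds h.rank_eq_one.self_of_nhds h.orthogonal.self_of_nhds
  have hO : (Qᵀ * U)ᵀ * (Qᵀ * U) = 1 := by
    have hQQ : Q * Qᵀ = 1 := mul_eq_one_comm.1 hQ.1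
    rw [transpose_mul, transpose_transpose, Matrix.mul_assoc, ← Matrix.mul_assoc Q, hQQ,
      Matrix.one_mul, hU]
  -- Orders take values in `ℕ∞` because an eigenvalue may vanish identically.
  let f : Fin n → ℕ∞ := fun j => analyticOrderAt (lam j) 0
  -- Limiting eigenvectors of eigenvalues of order below `2s` are orthonormal and lie in the span of
  -- the columns of `Q` of degree `< s`.
  have hcard : ∀ s : ℕ, (Finset.univ.filter fun j => f j < (2 * s : ℕ)).card ≤
      (Finset.univ.filter fun i : Fin n => mdeg (e i) < s).card := by
    intro s
    refine card_le_of_orthogonal hO fun i hi j hj => ?_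
    simp only [Finset.mem_filter, Finset.mem_univ, true_and, not_lt] at hi hj
    have hne : analyticOrderAt (lam j) 0 ≠ ⊤ := ne_top_of_lt hj
    obtain ⟨g, hgA, hg0, hg⟩ := (h.analytic_lam j).analyticOrderAt_ne_top.1 hne
    have ho : analyticOrderNatAt (lam j) 0 < 2 * s := by
      rw [← Nat.cast_lt (α := ℕ∞), Nat.cast_analyticOrderNatAt hne]
      exact hj
    refine h.col_dotProduct_eq_zero he hn' hΩ hΩ0 hK hQ hε₀ hpsd (hP j) hg0
      (o := analyticOrderNatAt (lam j) 0) ?_ (by omega)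
    refine (hgA.continuousAt.tendsto.mono_left nhdsWithin_le_nhds).congr' ?_
    filter_upwards [hg.filter_mono nhdsWithin_le_nhds, self_mem_nhdsWithin] with ε h1 h2
    have : ε ^ analyticOrderNatAt (lam j) 0 ≠ 0 := pow_ne_zero _ h2
    rw [h1, sub_zero, smul_eq_mul, mul_div_cancel_left₀ _ this]
  -- Sorting by order suffices: a violation at `j` would give `j + 1` eigenvalues of order below `2
  -- * mdeg (e j)`, whereas at most `j` positions have degree below `mdeg (e j)`.
  have hord : ∀ j : Fin n, ((2 * mdeg (e j) : ℕ) : ℕ∞) ≤ f (Tuple.sort f j) := by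
    intro j
    by_contra! hlt
    have h1 : (Finset.Iic j).image (Tuple.sort f) ⊆
        Finset.univ.filter fun i => f i < (2 * mdeg (e j) : ℕ) := by
      intro i hi
      obtain ⟨i', hi', rfl⟩ := Finset.mem_image.1 hi
      exact Finset.mem_filter.2 ⟨Finset.mem_univ _,
        (Tuple.monotone_sort f (Finset.mem_Iic.1 hi')).trans_lt hlt⟩
    have h2 : (Finset.univ.filter fun i : Fin n => mdeg (e i) < mdeg (e j)) ⊆ Finset.Iio j := by
      intro i hi
      exact Finset.mem_Iio.2 (he _ _ (Finset.mem_filter.1 hi).2)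
    have h3 := Finset.card_le_card h1
    have h4 := Finset.card_le_card h2
    rw [Finset.card_image_of_injective _ (Tuple.sort f).injective, Fin.card_Iic] at h3
    rw [Fin.card_Iio] at h4
    have := hcard (mdeg (e j))
    omega
  have hmain : ∀ j : Fin n, ∃ μ : ℝ, ∃ r : ℝ → ℝ, r =O[𝓝 0] (fun ε => ε) ∧ ∀ᶠ ε in 𝓝 (0 : ℝ),
      lam (Tuple.sort f j) ε = ε ^ (2 * mdeg (e j)) * (μ + r ε) := by
    intro j
    obtain ⟨g, hgA, hg⟩ := (natCast_le_analyticOrderAt (h.analytic_lam _)).1 (hord j)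
    refine ⟨g 0, fun ε => g ε - g 0, ?_, ?_⟩
    · simpa using hgA.differentiableAt.isBigO_sub
    · filter_upwards [hg] with ε hε
      rw [hε, sub_zero, smul_eq_mul, add_sub_cancel]
  choose μ hμ using hmain
  exact ⟨Tuple.sort f, μ, hμ⟩

/-- Compare traces at `ε = 0`: every eigenvalue of positive degree vanishes there, and only one
multi-index has degree zero. -/
theorem HasMainTerms.eq_card_mul {μ : Fin n → ℝ} (h : IsAnalyticEVD (kernelMatrix K x) lam P)
    (hμ : HasMainTerms e lam μ) {j : Fin n} (hj : mdeg (e j) = 0) : μ j = n * K 0 0 := by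
  have h1 : (kernelMatrix K x 0).trace = n * K 0 0 := by
    simp [trace, kernelMatrix]
  have h2 : (kernelMatrix K x 0).trace = ∑ i, lam i 0 := by
    rw [h.eq_sum.self_of_nhds, trace_sum]
    refine Finset.sum_congr rfl fun i _ => ?_
    rw [trace_smul, trace_eq_rank_of_idempotent (h.isIdempotent.self_of_nhds i),
      h.rank_eq_one.self_of_nhds i, Nat.cast_one, smul_eq_mul, mul_one]
  have h3 : ∀ i, lam i 0 = 0 ^ (2 * mdeg (e i)) * μ i := by
    intro i
    obtain ⟨r, hr, hl⟩ := hμ i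
    rw [hl.self_of_nhds, hr.eq_zero_imp.self_of_nhds rfl, add_zero]
  rw [← h1, h2, Finset.sum_eq_single j]
  · rw [h3, hj]; simp
  · intro i _ hij
    have : mdeg (e i) ≠ 0 := by
      intro h0
      have hz : ∀ l : Fin n, mdeg (e l) = 0 → e l = 0 := by
        intro l hl
        funext a
        rw [mdeg, Finset.sum_eq_zero_iff] at hl
        exact hl a (Finset.mem_univ a)
      exact hij (Fin.ext (e.injective ((hz i h0).trans (hz j hj).symm)))
    rw [h3, zero_pow (by omega), zero_mul]
  · simp

/-- The identities satisfied by the main terms of the eigenvalues. -/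
theorem HasMainTerms.main_terms {μ : Fin n → ℝ} (he : IsGradedEnum e)
    (hn' : n ≤ (degLT d (k + 1)).card) (hΩ : IsOpen Ω) (hΩ0 : (0 : Fin d → ℝ) ∈ Ω)
    (hK : IsCmm (k + 1) Ω K) (hQ : IsFullQR e (vandermondeND x (degLT d k)) Q)
    (h : IsAnalyticEVD (kernelMatrix K x) lam P) (hμ : HasMainTerms e lam μ) {s : ℕ}
    (hC : ((limitMatrix K e x Q).subBlock (fun j => mdeg (e j) < s)
      (fun j => mdeg (e j) < s)).det ≠ 0) :
    ∏ j : {j : Fin n // mdeg (e j) < s}, μ j = ((limitMatrix K e x Q).subBlock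
        (fun j => mdeg (e j) < s) (fun j => mdeg (e j) < s)).det ∧
      (gradedSchur (fun j : Fin n => mdeg (e j)) (limitMatrix K e x Q) s).charpoly =
        ∏ j : {j : Fin n // mdeg (e j) = s}, (X - Polynomial.C (μ j)) :=
  graded_main_terms (deg := fun j : Fin n => mdeg (e j)) (fun t =>
    det_limit_eq_prod (tendsto_transpose_mul_kernelMatrix_mul he hn' hΩ hΩ0 hK hQ) hμ.tendsto
      ((h.eventually_det hQ.1).filter_mono nhdsWithin_le_nhds) s t) hC

/-- Limiting eigenvectors are orthogonal to the columns of `Q` belonging to another side of a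
degree below which all main terms are nonzero. -/
theorem HasMainTerms.orthogonal_blocks {μ : Fin n → ℝ} (he : IsGradedEnum e)
    (hn' : n ≤ (degLT d (k + 1)).card) (hΩ : IsOpen Ω) (hΩ0 : (0 : Fin d → ℝ) ∈ Ω)
    (hK : IsCmm (k + 1) Ω K) (hQ : IsFullQR e (vandermondeND x (degLT d k)) Q) {ε₀ : ℝ}
    (hε₀ : 0 < ε₀) (hpsd : ∀ ε ∈ Set.Icc 0 ε₀, (kernelMatrix K x ε).PosSemidef)
    (h : IsAnalyticEVD (kernelMatrix K x) lam P) (hμ : HasMainTerms e lam μ)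
    {U : Matrix (Fin n) (Fin n) ℝ} (hU : Uᵀ * U = 1)
    (hP : ∀ j, P j 0 = vecMulVec (U.col j) (U.col j)) {r : ℕ}
    (hr : ∀ j : Fin n, mdeg (e j) < r → μ j ≠ 0) (i j : Fin n)
    (hij : ¬ (mdeg (e i) < r ↔ mdeg (e j) < r)) : (Qᵀ * U) i j = 0 := by
  have hO : (Qᵀ * U)ᵀ * (Qᵀ * U) = 1 := by
    have hQQ : Q * Qᵀ = 1 := mul_eq_one_comm.1 hQ.1
    rw [transpose_mul, transpose_transpose, Matrix.mul_assoc, ← Matrix.mul_assoc Q, hQQ,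
      Matrix.one_mul, hU]
  -- A nonzero main term fixes the order of `lam j` at `2 * mdeg (e j)`, which is below `2 * mdeg (e
  -- i)`. This gives one triangular half; orthogonality gives the other.
  have h1 : ∀ i j : Fin n, ¬ mdeg (e i) < r → mdeg (e j) < r → (Qᵀ * U) i j = 0 :=
    fun i j hi hj => h.col_dotProduct_eq_zero he hn' hΩ hΩ0 hK hQ hε₀ hpsd (hP j) (hr j hj)
      (hμ.tendsto j) (by omega)
  by_cases hi : mdeg (e i) < r
  · exact orthogonal_eq_zero_of_triangular hO (fun i : Fin n => mdeg (e i) < r) h1 i j hi (by tauto)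
  · exact h1 i j hi (by tauto)

theorem span_eq_of_orthogonal {U : Matrix (Fin n) (Fin n) ℝ} (hQ : Qᵀ * Q = 1) (hU : Uᵀ * U = 1)
    {s : ℕ} (h : ∀ i j : Fin n, ¬ (mdeg (e i) = s ↔ mdeg (e j) = s) → (Qᵀ * U) i j = 0) :
    Submodule.span ℝ (Set.range fun j : GroupIdx n e s => U.col j) =
      Submodule.span ℝ (Set.range (blockQ e Q s).col) := by
  have hQQ : Q * Qᵀ = 1 := mul_eq_one_comm.1 hQ
  have hUU : U * Uᵀ = 1 := mul_eq_one_comm.1 hU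
  have e1 : U = Q * (Qᵀ * U) := by rw [← Matrix.mul_assoc, hQQ, Matrix.one_mul]
  have e2 : Q = U * (Qᵀ * U)ᵀ := by
    rw [transpose_mul, transpose_transpose, ← Matrix.mul_assoc, hUU, Matrix.one_mul]
  apply le_antisymm
  · rw [Submodule.span_le]
    rintro _ ⟨j, rfl⟩
    have : U.col j = ∑ i, (Qᵀ * U) i j • Q.col i := by
      funext a
      conv_lhs => rw [e1]
      rw [col_apply, mul_apply, Finset.sum_apply]
      exact Finset.sum_congr rfl fun i _ => mul_comm _ _
    change U.col j ∈ _
    rw [this]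
    refine Submodule.sum_mem _ fun i _ => ?_
    by_cases hi : mdeg (e i) = s
    · exact Submodule.smul_mem _ _ (Submodule.subset_span ⟨⟨i, hi⟩, rfl⟩)
    · rw [h i j (by have := j.2; tauto), zero_smul]
      exact Submodule.zero_mem _
  · rw [Submodule.span_le]
    rintro _ ⟨i, rfl⟩
    have : Q.col i = ∑ j, (Qᵀ * U) i j • U.col j := by
      funext a
      conv_lhs => rw [e2]
      rw [col_apply, mul_apply, Finset.sum_apply]
      exact Finset.sum_congr rfl fun j _ => mul_comm _ _
    change Q.col i ∈ _
    rw [this]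
    refine Submodule.sum_mem _ fun j _ => ?_
    by_cases hj : mdeg (e j) = s
    · exact Submodule.smul_mem _ _ (Submodule.subset_span ⟨⟨j, hj⟩, rfl⟩)
    · rw [h i j (by have := i.2; tauto), zero_smul]
      exact Submodule.zero_mem _

/-- Symmetry is given only for `ε ≥ 0`; analyticity extends it to negative `ε`. -/
theorem kernelMatrix_eventually_isSymm {ε₀ : ℝ} (hε₀ : 0 < ε₀)
    (hpsd : ∀ ε ∈ Set.Icc 0 ε₀, (kernelMatrix K x ε).PosSemidef)
    (han : EntryAnalytic (kernelMatrix K x)) : ∀ᶠ ε in 𝓝 0, (kernelMatrix K x ε).IsSymm := by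
  refine EntryAnalytic.eventually_eq (M := fun ε => (kernelMatrix K x ε)ᵀ)
    (fun a b => han b a) han ?_
  have h1 : ∀ᶠ ε in 𝓝[>] (0 : ℝ), (kernelMatrix K x ε)ᵀ = kernelMatrix K x ε := by
    filter_upwards [Ioc_mem_nhdsGT hε₀] with ε hε
    have := (hpsd ε ⟨hε.1.le, hε.2⟩).isHermitian
    rwa [IsHermitian, conjTranspose_eq_transpose_of_trivial] at this
  exact h1.frequently.filter_mono (nhdsWithin_mono _ fun x hx => ne_of_gt hx)

end Kernel

theorem mainTheorem7 {d n k : ℕ} (e : ℕ ≃ (Fin d → ℕ)) (he : IsGradedEnum e)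
    (hn : (degLT d k).card < n) (hn' : n ≤ (degLT d (k + 1)).card)
    (Ω : Set (Fin d → ℝ)) (hΩ : IsOpen Ω) (hΩ0 : (0 : Fin d → ℝ) ∈ Ω)
    (K : (Fin d → ℝ) → (Fin d → ℝ) → ℝ) (hK : IsCmm (k + 1) Ω K)
    (x : Fin n → Fin d → ℝ) (ε₀ : ℝ) (hε₀ : 0 < ε₀)
    (hpsd : ∀ ε ∈ Set.Icc 0 ε₀, (kernelMatrix K x ε).PosSemidef)
    (han : ∀ i j, AnalyticAt ℝ (fun ε => kernelMatrix K x ε i j) 0)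
    (Q : Matrix (Fin n) (Fin n) ℝ) (hQ : IsFullQR e (vandermondeND x (degLT d k)) Q) :
    -- the eigenvalues and eigenprojectors can be chosen analytic near `0`
    (∃ lam P, IsAnalyticEVD (kernelMatrix K x) lam P) ∧
    -- the eigenvalues split into groups, with the stated orders
    (∀ lam P, IsAnalyticEVD (kernelMatrix K x) lam P →
      ∃ (σ : Equiv.Perm (Fin n)) (μ : Fin n → ℝ), HasMainTerms e (fun j => lam (σ j)) μ) ∧
    -- the main terms and the limiting eigenvectors, for every such splitting
    (∀ lam P μ, IsAnalyticEVD (kernelMatrix K x) lam P → HasMainTerms e lam μ →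
      (∀ j : Fin n, mdeg (e j) = 0 → μ j = n * K 0 0) ∧
      (∀ s : ℕ, 1 ≤ s → s < k → (wronskianMatrix K (degLT d s) (degLT d s)).det ≠ 0 →
        IsFullRank (vandermondeND x (degLT d s)) →
        ∏ j : GroupIdx n e s, μ j =
          ((vandermondeND x (degLT d (s + 1))).transpose *
              vandermondeND x (degLT d (s + 1))).det *
            (wronskianMatrix K (degLT d (s + 1)) (degLT d (s + 1))).det /
          (((vandermondeND x (degLT d s)).transpose * vandermondeND x (degLT d s)).det *
            (wronskianMatrix K (degLT d s) (degLT d s)).det)) ∧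
      (∀ s : ℕ, 1 ≤ s → s ≤ k → (wronskianMatrix K (degLT d s) (degLT d s)).det ≠ 0 →
        IsFullRank (vandermondeND x (degLT d s)) →
        (groupMatrix K x e Q s).charpoly = ∏ j : GroupIdx n e s, (X - C (μ j))) ∧
      (∀ p : Fin n → Fin n → ℝ, (∀ j, P j 0 = Matrix.vecMulVec (p j) (p j)) →
        (∀ s : ℕ, s < k →
          (wronskianMatrix K (degLT d (s + 1)) (degLT d (s + 1))).det ≠ 0 →
          IsFullRank (vandermondeND x (degLT d (s + 1))) →
          Submodule.span ℝ (Set.range fun j : GroupIdx n e s => p j) =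
            Submodule.span ℝ (Set.range (blockQ e Q s).col)) ∧
        ((wronskianMatrix K (degLT d k) (degLT d k)).det ≠ 0 →
          IsFullRank (vandermondeND x (degLT d k)) →
          Submodule.span ℝ (Set.range fun j : GroupIdx n e k => p j) =
            Submodule.span ℝ (Set.range (blockQ e Q k).col)))) := by
  have hsymm := kernelMatrix_eventually_isSymm hε₀ hpsd han
  refine ⟨exists_isAnalyticEVD han hsymm,
    fun lam P h => exists_labelling he hn' hΩ hΩ0 hK hQ hε₀ hpsd h, fun lam P μ h hμ => ?_⟩
  have hC : ∀ s ≤ k, (wronskianMatrix K (degLT d s) (degLT d s)).det ≠ 0 →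
      IsFullRank (vandermondeND x (degLT d s)) → ((limitMatrix K e x Q).subBlock
        (fun j => mdeg (e j) < s) (fun j => mdeg (e j) < s)).det ≠ 0 := by
    intro s hs hW hV
    rw [det_limitMatrix_subBlock_lt hQ he hn hs]
    exact mul_ne_zero (pow_ne_zero _ (diagProd_ne_zero hQ he hn hs hV)) hW
  -- The main terms of degree `< s` have nonzero product, namely the determinant from `hC`.
  have hμ0 : ∀ s ≤ k, (wronskianMatrix K (degLT d s) (degLT d s)).det ≠ 0 →
      IsFullRank (vandermondeND x (degLT d s)) → ∀ j : Fin n, mdeg (e j) < s → μ j ≠ 0 := by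
    intro s hs hW hV j hj
    have hCs := hC s hs hW hV
    rw [← (hμ.main_terms he hn' hΩ hΩ0 hK hQ h hCs).1, Finset.prod_ne_zero_iff] at hCs
    exact hCs ⟨j, hj⟩ (Finset.mem_univ _)
  have hgroup : ∀ s ≤ k, (wronskianMatrix K (degLT d s) (degLT d s)).det ≠ 0 →
      IsFullRank (vandermondeND x (degLT d s)) →
      (groupMatrix K x e Q s).charpoly = ∏ j : GroupIdx n e s, (X - C (μ j)) := by
    intro s hs hW hV
    rw [← gradedSchur_eq_groupMatrix hQ he hn hs (diagProd_ne_zero hQ he hn hs hV)]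
    exact (hμ.main_terms he hn' hΩ hΩ0 hK hQ h (hC s hs hW hV)).2
  refine ⟨fun j hj => hμ.eq_card_mul h hj, fun s _ hs hW hV => ?_,
    fun s _ hs hW hV => hgroup s hs hW hV, fun p hp => ?_⟩
  · have hD := diagProd_ne_zero hQ he hn hs.le hV
    -- The product is read off the constant coefficient of the characteristic polynomial. The
    -- quotient formula follows because both Gram determinants are squares of diagonal products of
    -- `R`, while the Wronskian determinants differ by the factor `det W̃_s`.
    have h1 : ∏ j : GroupIdx n e s, μ j = (groupMatrix K x e Q s).det := by
      rw [Matrix.det_eq_sign_charpoly_coeff, hgroup s hs.le hW hV, Polynomial.coeff_zero_eq_eval_zero,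
        Polynomial.eval_prod, ← Finset.card_univ, ← Finset.prod_const, ← Finset.prod_mul_distrib]
      exact Finset.prod_congr rfl fun j _ => by simp
    rw [h1, ← gradedSchur_eq_groupMatrix hQ he hn hs.le hD, det_gradedSchur hQ he hn hs hD,
      det_gram_vandermondeND hQ he hn (Nat.succ_le_of_lt hs), det_gram_vandermondeND hQ he hn hs.le,
      det_wronskianMatrix_succ hW, diagProd_succ]
    field_simp
  · let U : Matrix (Fin n) (Fin n) ℝ := (Matrix.of p).transpose
    have hUp : ∀ j, U.col j = p j := fun j => rfl
    have hpp : ∀ j, p j ⬝ᵥ p j = 1 := fun j => by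
      refine dotProduct_self_of_vecMulVec ?_ ?_
      · rw [← hp]; exact h.isIdempotent.self_of_nhds j
      · rw [← hp]; exact h.rank_eq_one.self_of_nhds j
    have hU : U.transpose * U = 1 := by
      ext i j
      rw [Matrix.mul_apply]
      change p i ⬝ᵥ p j = _
      by_cases hij : i = j
      · subst hij; rw [hpp, Matrix.one_apply_eq]
      · rw [Matrix.one_apply_ne hij]
        refine vecMulVec_mul_eq_zero (hpp i) (hpp j) ?_
        rw [← hp, ← hp]
        exact h.orthogonal.self_of_nhds i j hij
    have hblock : ∀ r, (∀ j : Fin n, mdeg (e j) < r → μ j ≠ 0) → ∀ i j : Fin n,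
        ¬ (mdeg (e i) < r ↔ mdeg (e j) < r) → (Q.transpose * U) i j = 0 := fun r hr =>
      hμ.orthogonal_blocks he hn' hΩ hΩ0 hK hQ hε₀ hpsd h hU hp hr
    refine ⟨fun s hs hW hV => ?_, fun hW hV => ?_⟩
    -- Degree `s` is isolated by two cuts, at `s` and at `s + 1`; the nonvanishing up to degree `s`
    -- serves both.
    · have h0 := hμ0 (s + 1) hs hW hV
      refine span_eq_of_orthogonal hQ.1 hU fun i j hij => ?_
      by_cases h1 : mdeg (e i) < s ↔ mdeg (e j) < s
      · exact hblock (s + 1) h0 i j (by omega)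
      · exact hblock s (fun j hj => h0 j (by omega)) i j h1
    -- Degrees never exceed `k`, so the single cut at `k` isolates the last group and its own main
    -- terms may vanish.
    · have h0 := hμ0 k le_rfl hW hV
      refine span_eq_of_orthogonal hQ.1 hU fun i j hij => hblock k h0 i j ?_
      have := he.mdeg_le hn' i
      have := he.mdeg_le hn' j
      omega
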